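/- Let $M$ be a smooth real supermanifold of dimension $p|q$ with an odd Poisson (Schouten) bracket $\{\ ,\ \}$: an odd bracket on the structure sheaf, of parity $\widetilde{\{f,g\}}=\tilde f+\tilde g+1$, with $\{f,g\}=-(-1)^{(\tilde f+1)(\tilde g+1)}\{g,f\}$, $\{f,gh\}=\{f,g\}h+(-1)^{(\tilde f+1)\tilde g}g\{f,h\}$ and the Jacobi identity $\{f,\{g,h\}\}=\{\{f,g\},h\}+(-1)^{(\tilde f+1)(\tilde g+1)}\{g,\{f,h\}\}$. For a homogeneous function $f$ let $X_f=(-1)^{\tilde f+1}\{f,\ \cdot\ \}$ be its Hamiltonian vector field. Let $\boldsymbol\rho=\rho\,Dx$ be a non-degenerate volume form on $M$, that is, a section of the Berezinian bundle whose coefficient in every chart is even and invertible, with $\rho=\rho'\,\mathrm{Ber}(\partial x'/\partial x)$ under changes of coordinates. The Lie derivative of $\boldsymbol\rho$ along a homogeneous vector field $X=X^a\,\partial/\partial x^a$ is $$L_X\boldsymbol\rho=\Bigl(\sum_a(-1)^{\tilde a(\tilde X+1)}\frac{\partial(\rho X^a)}{\partial x^a}\Bigr)Dx .$$ Then there is a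 unique linear operator $\Delta_{\boldsymbol\rho}$ on functions (on all open subsets of $M$), the odd Laplace operator, with $(\Delta_{\boldsymbol\rho}f)\,\boldsymbol\rho=L_{X_f}\boldsymbol\rho$ for all homogeneous $f$; its square $Y=\Delta_{\boldsymbol\rho}^2$ is an even vector field on $M$ (the modular field of $M$ with respect to $\boldsymbol\rho$); and $Y$ preserves the volume form: $L_Y\boldsymbol\rho=0$. -/

import Mathlib

open CategoryTheory TopologicalSpace Opposite
open scoped ContDiff

universe u

/-! ### Superspaces -/

/-- The sign `(-1)^i` of a parity `i ∈ ℤ/2`. -/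
def koszulSign (i : ZMod 2) : ℝ := if i = 0 then 1 else -1

/-- A (real) superspace: a topological space with a sheaf of `ℤ/2`-graded supercommutative
associative unital real algebras. -/
structure SuperSpace where
  /-- the underlying topological space -/
  carrier : TopCat.{u}
  /-- the structure sheaf -/
  sheaf : TopCat.Sheaf (AlgCat.{u} ℝ) carrier
  /-- the homogeneous sections of a given parity -/
  gr : ∀ V : Opens carrier, ZMod 2 → Submodule ℝ (sheaf.presheaf.obj (op V))
  gr_isCompl : ∀ V, IsCompl (gr V 0) (gr V 1)
  one_mem_gr : ∀ V, (1 : sheaf.presheaf.obj (op V)) ∈ gr V 0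
  mul_mem_gr : ∀ V i j, ∀ f ∈ gr V i, ∀ g ∈ gr V j, f * g ∈ gr V (i + j)
  mul_comm_gr : ∀ V i j, ∀ f ∈ gr V i, ∀ g ∈ gr V j, f * g = koszulSign (i * j) • (g * f)
  res_mem_gr : ∀ V W (h : W ≤ V) i, ∀ f ∈ gr V i,
    (sheaf.presheaf.map (homOfLE h).op).hom f ∈ gr W i

namespace SuperSpace

/-- The algebra `𝒪(V)` of functions on the open set `V`. -/
abbrev sec (X : SuperSpace.{u}) (V : Opens X.carrier) : Type u :=
  X.sheaf.presheaf.obj (op V)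

/-- Restriction of functions. -/
def res (X : SuperSpace.{u}) {V W : Opens X.carrier} (h : W ≤ V) : X.sec V →ₐ[ℝ] X.sec W :=
  (X.sheaf.presheaf.map (homOfLE h).op).hom

/-- The algebra of even functions on `V`. -/
def evenPart (X : SuperSpace.{u}) (V : Opens X.carrier) : Subalgebra ℝ (X.sec V) where
  carrier := X.gr V 0
  mul_mem' := fun {a b} ha hb => by
    have h := X.mul_mem_gr V 0 0 a ha b hb
    rwa [add_zero] at h
  one_mem' := X.one_mem_gr V
  add_mem' := fun ha hb => (X.gr V 0).add_mem ha hb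
  zero_mem' := (X.gr V 0).zero_mem
  algebraMap_mem' := fun r => by
    rw [Algebra.algebraMap_eq_smul_one]
    exact (X.gr V 0).smul_mem r (X.one_mem_gr V)

instance (X : SuperSpace.{u}) (V : Opens X.carrier) : CommRing (X.evenPart V) :=
  { (inferInstance : Ring (X.evenPart V)) with
    mul_comm := fun a b => Subtype.ext (by
      have h := X.mul_comm_gr V 0 0 a.1 a.2 b.1 b.2
      simpa [koszulSign] using h) }

/-- The even component of a function. -/
noncomputable def evenProj (X : SuperSpace.{u}) (V : Opens X.carrier) (f : X.sec V) :
    X.evenPart V :=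
  ⟨((X.gr V 0).projectionOnto (X.gr V 1) (X.gr_isCompl V) f : X.gr V 0).1,
    ((X.gr V 0).projectionOnto (X.gr V 1) (X.gr_isCompl V) f : X.gr V 0).2⟩

/-- The Berezinian `Ber J = det (A - B D⁻¹ C) · det D⁻¹` of an even invertible supermatrix
`J = [[A, B], [C, D]]` of size `p|q`: the entries of `A`, `D` are even, those of `B`, `C` are odd.
(The determinants are taken over the commutative ring of even functions; for such a matrix
`evenProj` does not change the entries that it is applied to.) -/
noncomputable def berezinian (X : SuperSpace.{u}) {p q : ℕ} (V : Opens X.carrier)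
    (J : Matrix (Fin p ⊕ Fin q) (Fin p ⊕ Fin q) (X.sec V)) : X.evenPart V :=
  let Dinv : Matrix (Fin q) (Fin q) (X.evenPart V) := (J.toBlocks₂₂.map (X.evenProj V))⁻¹
  ((J.toBlocks₁₁ - J.toBlocks₁₂ * Dinv.map (fun a => (a : X.sec V)) * J.toBlocks₂₁).map
    (X.evenProj V)).det * Dinv.det

end SuperSpace

/-! ### Smooth functions on open subsets of `ℝ^p` -/

theorem extend_val_of_mem {p : ℕ} {Ω : Opens (Fin p → ℝ)} (f : Ω → ℝ) {x : Fin p → ℝ}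
    (hx : x ∈ (Ω : Set (Fin p → ℝ))) : Function.extend Subtype.val f 0 x = f ⟨x, hx⟩ :=
  Subtype.val_injective.extend_apply f 0 (⟨x, hx⟩ : Ω)

/-- The algebra `C^∞(Ω)` for an open set `Ω ⊆ ℝ^p`. (The values of the extension outside `Ω` play
no role.) -/
def smoothFunctions {p : ℕ} (Ω : Opens (Fin p → ℝ)) : Subalgebra ℝ (Ω → ℝ) where
  carrier := {f | ContDiffOn ℝ ∞ (Function.extend Subtype.val f 0) (Ω : Set (Fin p → ℝ))}
  mul_mem' := fun {a b} ha hb => (ContDiffOn.mul ha hb).congr fun x hx => by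
    simp [extend_val_of_mem _ hx]
  add_mem' := fun {a b} ha hb => (ContDiffOn.add ha hb).congr fun x hx => by
    simp [extend_val_of_mem _ hx]
  algebraMap_mem' := fun r => (contDiffOn_const (c := r)).congr fun x hx => by
    simp [extend_val_of_mem _ hx]

namespace smoothFunctions

/-- Restriction of smooth functions. -/
def restrict {p : ℕ} {Ω Ω' : Opens (Fin p → ℝ)} (h : Ω' ≤ Ω) (f : smoothFunctions Ω) :
    smoothFunctions Ω' :=
  ⟨fun x => f.1 ⟨x.1, h x.2⟩, (ContDiffOn.mono f.2 h).congr fun x hx => by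
    rw [extend_val_of_mem _ hx, extend_val_of_mem _ (h hx)]⟩

/-- The `i`-th coordinate function. -/
def coordinate {p : ℕ} (Ω : Opens (Fin p → ℝ)) (i : Fin p) : smoothFunctions Ω :=
  ⟨fun x => x.1 i, (contDiff_apply ℝ ℝ i).contDiffOn.congr fun x hx => by
    rw [extend_val_of_mem _ hx]⟩

/-- The partial derivative `∂f/∂x^i`. -/
noncomputable def partialDeriv {p : ℕ} {Ω : Opens (Fin p → ℝ)} (i : Fin p)
    (f : smoothFunctions Ω) : smoothFunctions Ω :=
  ⟨fun x => fderiv ℝ (Function.extend Subtype.val f.1 0) x.1 (Pi.single i 1),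
    ((f.2.fderiv_of_isOpen Ω.isOpen (m := ∞) (by simp)).clm_apply
      (contDiffOn_const (c := (Pi.single i 1 : Fin p → ℝ)))).congr fun x hx => by
    rw [extend_val_of_mem _ hx]⟩

end smoothFunctions

/-! ### Charts and supermanifolds -/

/-- The image in `ℝ^p` of (the part in the source of `φ` of) an open set `W`. -/
def openImage {M : Type u} [TopologicalSpace M] {p : ℕ}
    (φ : OpenPartialHomeomorph M (Fin p → ℝ)) (W : Opens M) : Opens (Fin p → ℝ) :=
  ⟨φ.target ∩ φ.symm ⁻¹' W, φ.isOpen_inter_preimage_symm W.isOpen⟩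

theorem openImage_mono {M : Type u} [TopologicalSpace M] {p : ℕ}
    (φ : OpenPartialHomeomorph M (Fin p → ℝ)) {W W' : Opens M} (h : W' ≤ W) :
    openImage φ W' ≤ openImage φ W :=
  fun _ hx => ⟨hx.1, h hx.2⟩

namespace SuperSpace

/-- A chart of dimension `p|q`: an isomorphism of superspaces between an open part `U` of `X` and
an open part of `ℝ^{p|q}`, the latter having the structure sheaf `Ω ↦ C^∞(Ω) ⊗ Λ(θ^1, …, θ^q)`.
It is given by a homeomorphism `φ` of `U` onto an open subset of `ℝ^p`, by the homomorphisms
`C^∞(φ(W)) → 𝒪(W)`, and by the images `θ^j ∈ 𝒪(U)` of the generators; it is an isomorphism when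
over every open `W ⊆ U` each section has a unique expansion `∑_I f_I θ^I`, `f_I ∈ C^∞(φ(W))`. -/
structure Chart (X : SuperSpace.{u}) (p q : ℕ) where
  φ : OpenPartialHomeomorph X.carrier (Fin p → ℝ)
  /-- the domain `U` of the chart -/
  dom : Opens X.carrier
  dom_eq : (dom : Set X.carrier) = φ.source
  pull : ∀ W, W ≤ dom → smoothFunctions (openImage φ W) →ₐ[ℝ] X.sec W
  pull_even : ∀ W h f, pull W h f ∈ X.gr W 0
  res_pull : ∀ W W' (h : W ≤ dom) (h' : W' ≤ W) f,
    X.res h' (pull W h f) =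
      pull W' (h'.trans h) (smoothFunctions.restrict (openImage_mono φ h') f)
  θ : Fin q → X.sec dom
  θ_odd : ∀ j, θ j ∈ X.gr dom 1
  expansion_bijective : ∀ W (h : W ≤ dom),
    Function.Bijective (fun f : Finset (Fin q) → smoothFunctions (openImage φ W) =>
      ∑ I : Finset (Fin q), pull W h (f I) * ((I.sort.map fun j => X.res h (θ j)).prod))

/-- The parity of the coordinate with a given index: the first `p` coordinates are even, the
last `q` are odd. -/
def coordParity {p q : ℕ} (a : Fin p ⊕ Fin q) : ZMod 2 :=
  Sum.elim (fun _ => 0) (fun _ => 1) a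

namespace Chart

/-- The monomial `θ^I = θ^{i_1} ⋯ θ^{i_k}`, `I = {i_1 < ⋯ < i_k}`, on `W`. -/
def thetaMonomial {X : SuperSpace.{u}} {p q : ℕ} (c : X.Chart p q) {W : Opens X.carrier}
    (h : W ≤ c.dom) (I : Finset (Fin q)) : X.sec W :=
  (I.sort.map fun j => X.res h (c.θ j)).prod

/-- The coefficients `f_I ∈ C^∞(φ(W))` of `f = ∑_I f_I θ^I ∈ 𝒪(W)`. -/
noncomputable def coeff {X : SuperSpace.{u}} {p q : ℕ} (c : X.Chart p q) {W : Opens X.carrier}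
    (h : W ≤ c.dom) (f : X.sec W) : Finset (Fin q) → smoothFunctions (openImage c.φ W) :=
  (Equiv.ofBijective _ (c.expansion_bijective W h)).symm f

/-- The coordinates `x^a = (x^1, …, x^p, θ^1, …, θ^q)` of the chart. -/
def coord {X : SuperSpace.{u}} {p q : ℕ} (c : X.Chart p q) (a : Fin p ⊕ Fin q) : X.sec c.dom :=
  Sum.elim (fun i => c.pull c.dom le_rfl (smoothFunctions.coordinate _ i)) c.θ a

/-- The (left) partial derivatives `∂/∂x^a` on `𝒪(W)`, `W ⊆ U`:
`∂/∂x^i (f_I θ^I) = (∂f_I/∂x^i) θ^I`, and `∂/∂θ^j (f_I θ^I)` is `(-1)^k f_I θ^{I ∖ j}` if `j ∈ I`,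
where `k` is the number of elements of `I` below `j`, and zero otherwise. -/
noncomputable def pderiv {X : SuperSpace.{u}} {p q : ℕ} (c : X.Chart p q)
    (a : Fin p ⊕ Fin q) {W : Opens X.carrier} (h : W ≤ c.dom) (f : X.sec W) : X.sec W :=
  match a with
  | Sum.inl i => ∑ I : Finset (Fin q),
      c.pull W h (smoothFunctions.partialDeriv i (c.coeff h f I)) * c.thetaMonomial h I
  | Sum.inr j => ∑ I : Finset (Fin q), if j ∈ I then
      (-1 : ℝ) ^ (I.filter (· < j)).card •
        (c.pull W h (c.coeff h f I) * c.thetaMonomial h (I.erase j)) else 0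

/-- The Jacobian matrix `∂x'^b/∂x^a` (row `a`, column `b`) of two charts on the intersection of
their domains. -/
noncomputable def jacobian {X : SuperSpace.{u}} {p q : ℕ} (c c' : X.Chart p q) :
    Matrix (Fin p ⊕ Fin q) (Fin p ⊕ Fin q) (X.sec (c.dom ⊓ c'.dom)) :=
  Matrix.of fun a b => c.pderiv a inf_le_left (X.res inf_le_right (c'.coord b))

end Chart

end SuperSpace

/-- A smooth supermanifold of dimension `p|q`: a superspace, Hausdorff and second countable,
which is locally isomorphic to `ℝ^{p|q}`. -/
structure Supermanifold (p q : ℕ) extends SuperSpace.{u} where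
  t2 : T2Space carrier
  secondCountable : SecondCountableTopology carrier
  exists_chart : ∀ x : carrier, ∃ c : toSuperSpace.Chart p q, x ∈ c.dom

/-- The charts of a supermanifold: all local isomorphisms with `ℝ^{p|q}`. -/
abbrev Supermanifold.Atlas {p q : ℕ} (M : Supermanifold.{u} p q) : Type u :=
  M.toSuperSpace.Chart p q

/-! ### Vector fields, odd Poisson brackets, volume forms -/

/-- A vector field of parity `ε` on an open set `V`: a superderivation of parity `ε` of the
structure sheaf over `V`. -/
structure SuperVectorField (X : SuperSpace.{u}) (V : Opens X.carrier) (ε : ZMod 2) where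
  toFun : ∀ W, W ≤ V → X.sec W →ₗ[ℝ] X.sec W
  res_apply : ∀ W W' (h : W ≤ V) (h' : W' ≤ W) f,
    X.res h' (toFun W h f) = toFun W' (h'.trans h) (X.res h' f)
  mem_gr : ∀ W h i, ∀ f ∈ X.gr W i, toFun W h f ∈ X.gr W (ε + i)
  leibniz : ∀ W h i, ∀ f ∈ X.gr W i, ∀ g,
    toFun W h (f * g) = toFun W h f * g + koszulSign (ε * i) • (f * toFun W h g)

/-- An odd Poisson (Schouten) structure: an odd Poisson bracket on the structure sheaf. In local
coordinates such a bracket is given by an odd quadratic Hamiltonian `½ S^{ab} p_b p_a` as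
`{f, g} = -(-1)^{f̃ (ã + 1)} S^{ab} ∂_b f ∂_a g`. -/
structure OddPoissonStructure (X : SuperSpace.{u}) where
  bracket : ∀ V, X.sec V →ₗ[ℝ] X.sec V →ₗ[ℝ] X.sec V
  res_bracket : ∀ V W (h : W ≤ V) f g,
    X.res h (bracket V f g) = bracket W (X.res h f) (X.res h g)
  mem_gr : ∀ V i j, ∀ f ∈ X.gr V i, ∀ g ∈ X.gr V j, bracket V f g ∈ X.gr V (i + j + 1)
  antisymm : ∀ V i j, ∀ f ∈ X.gr V i, ∀ g ∈ X.gr V j,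
    bracket V f g = -(koszulSign ((i + 1) * (j + 1)) • bracket V g f)
  leibniz : ∀ V i j, ∀ f ∈ X.gr V i, ∀ g ∈ X.gr V j, ∀ k,
    bracket V f (g * k) =
      bracket V f g * k + koszulSign ((i + 1) * j) • (g * bracket V f k)
  jacobi : ∀ V i j, ∀ f ∈ X.gr V i, ∀ g ∈ X.gr V j, ∀ k,
    bracket V f (bracket V g k) =
      bracket V (bracket V f g) k +
        koszulSign ((i + 1) * (j + 1)) • bracket V g (bracket V f k)

/-- The Hamiltonian vector field `X_f = (-1)^{f̃ + 1} {f, ·}` on `V` of a homogeneous function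
`f ∈ 𝒪(V)`; its parity is opposite to that of `f`. -/
noncomputable def OddPoissonStructure.hamiltonian {X : SuperSpace.{u}} (B : OddPoissonStructure X)
    {V : Opens X.carrier} {i : ZMod 2} (f : X.sec V) (hf : f ∈ X.gr V i) :
    SuperVectorField X V (i + 1) where
  toFun W h := koszulSign (i + 1) • B.bracket W (X.res h f)
  res_apply W W' h h' g := by
    have hr : X.res h' (X.res h f) = X.res (h'.trans h) f := by
      have := X.sheaf.presheaf.map_comp (homOfLE h).op (homOfLE h').op
      exact (congrArg (fun t => t.hom f) this).symm
    simp [B.res_bracket, hr]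
  mem_gr W h j g hg := by
    have := B.mem_gr W i j _ (X.res_mem_gr V W h i f hf) g hg
    rw [show i + 1 + j = i + j + 1 by ring]
    exact (X.gr W _).smul_mem _ this
  leibniz W h j g hg k := by
    have := B.leibniz W i j _ (X.res_mem_gr V W h i f hf) g hg k
    change koszulSign (i + 1) • B.bracket W (X.res h f) (g * k) = _
    rw [show B.bracket W (X.res h f) (g * k) = _ from this, smul_add]
    congr 1
    · exact (smul_mul_assoc _ _ _).symm
    · change _ = koszulSign ((i + 1) * j) • (g * (koszulSign (i + 1) •
        B.bracket W (X.res h f) k))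
      rw [mul_smul_comm, smul_comm]
      rfl

/-- A volume form `ρ = ρ_c Dx` with even coefficients: a section of the Berezinian line bundle.
It is given by its coefficients `ρ_c` in all charts `c`; they satisfy `ρ_c = ρ_{c'} Ber (∂x'/∂x)`
on the intersection of the domains of two charts `c` and `c'` with coordinates `x` and `x'`. -/
structure VolumeForm {p q : ℕ} (M : Supermanifold.{u} p q) where
  coeff : ∀ c : M.Atlas, M.sec c.dom
  even : ∀ c, coeff c ∈ M.gr c.dom 0
  compatible : ∀ c c' : M.Atlas,
    M.res (inf_le_left : c.dom ⊓ c'.dom ≤ c.dom) (coeff c) =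
      M.res (inf_le_right : c.dom ⊓ c'.dom ≤ c'.dom) (coeff c') *
        (M.berezinian (c.dom ⊓ c'.dom) (c.jacobian c') : M.sec (c.dom ⊓ c'.dom))

namespace VolumeForm

/-- A volume form is non-degenerate if it is a basis of the module of volume forms, i.e. if its
coefficients are invertible. -/
def Nondegenerate {p q : ℕ} {M : Supermanifold.{u} p q} (ρ : VolumeForm M) : Prop :=
  ∀ c, IsUnit (ρ.coeff c)

/-- The coefficient `∑_a (-1)^{ã (X̃ + 1)} ∂(ρ_c X^a)/∂x^a`, in a chart `c` with domain inside
`V`, of the Lie derivative `L_X ρ` along a homogeneous vector field `X = X^a ∂/∂x^a` on `V`. -/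
noncomputable def lieDerivative {p q : ℕ} {M : Supermanifold.{u} p q} (ρ : VolumeForm M)
    {V : Opens M.carrier} {ε : ZMod 2} (X : SuperVectorField M.toSuperSpace V ε)
    (c : M.Atlas) (hc : c.dom ≤ V) : M.sec c.dom :=
  ∑ a : Fin p ⊕ Fin q, koszulSign (SuperSpace.coordParity a * (ε + 1)) •
    c.pderiv a le_rfl (ρ.coeff c * X.toFun c.dom hc (c.coord a))

/-- `Δ` is the Laplace operator of the volume form `ρ` on functions: `Δ f = (L_{X_f} ρ)/ρ`, i.e.
`(Δ f) ρ = L_{X_f} ρ`, for every homogeneous function `f` on every open set. -/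
def IsLaplaceOperator {p q : ℕ} {M : Supermanifold.{u} p q} (ρ : VolumeForm M)
    (B : OddPoissonStructure M.toSuperSpace)
    (Δ : ∀ V : Opens M.carrier, M.sec V →ₗ[ℝ] M.sec V) : Prop :=
  ∀ (V : Opens M.carrier) (i : ZMod 2) (f : M.sec V) (hf : f ∈ M.gr V i)
    (c : M.Atlas) (hc : c.dom ≤ V),
    M.res hc (Δ V f) * ρ.coeff c = ρ.lieDerivative (B.hamiltonian f hf) c hc

end VolumeForm

/-! ### Signs -/

/-! The function (L_{X_f} ρ)/ρ is the divergence of X_f, so Δ exists once divergences are shown not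
to depend on the chart. A vector field is determined by its values on coordinates
(`SuperVectorField.apply_eq_sum`, through Hadamard's lemma); applied to the fields ∂/∂x^a of another
chart, this gives the chain rule and the fact that the two Jacobian matrices are mutually inverse.
Rewriting Σ ∂_a(ρ X^a) in new coordinates then leaves a term with second derivatives of the
coordinate change. By Liouville's formula (`berezinian_liouville`), a signed trace of J⁻¹ ∂J, this
term is the logarithmic derivative of the Berezinian, which the change of ρ absorbs
(`superDiv_change`, `lieDerivative_compatible`). The local quotients agree on overlaps and glue.
Uniqueness holds because charts inside V cover V, ρ is invertible, and every function is a sum of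
homogeneous ones.

That Δ² is a derivation rests on two identities. First, Δ(fg) = Δf·g + (-1)^f̃ f·Δg - 2(-1)^f̃ {f,g}
(`laplacian_mul`), because X_{fg} is a combination of f X_g and g X_f. Second, Δ{f,g} = {Δf,g} +
(-1)^{f̃+1} {f,Δg} (`laplacian_bracket`), because the Jacobi identity makes X_{{f,g}} the
supercommutator of X_f and X_g, and div [X,Y] = X(div Y) ∓ Y(div X) (`superDiv_bracket`). On
expanding Δ²(fg), all mixed terms cancel.

For L_Y ρ = 0, let f be homogeneous with compact support in one chart. The Leibniz rule for
divergences gives f·L_Y ρ = L_{fY} ρ - (Yf)ρ, and (Yf)ρ = Δ(Δf)ρ is L_{X_{Δf}} ρ. Both terms are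
coordinate divergences of compactly supported fields, so f·L_Y ρ has Berezin integral zero. Since f
is arbitrary and the integral pairing is nondegenerate, L_Y ρ = 0. Everything happens in a fixed
chart, so no change of variables in the Berezin integral is needed. -/

theorem koszulSign_zero : koszulSign 0 = 1 := by simp [koszulSign]

theorem koszulSign_one : koszulSign 1 = -1 := by simp [koszulSign]

theorem koszulSign_add (i j : ZMod 2) : koszulSign (i + j) = koszulSign i * koszulSign j := by
  have h : ∀ k : ZMod 2, k = 0 ∨ k = 1 := by decide
  have h2 : (1 + 1 : ZMod 2) = 0 := by decide
  rcases h i with rfl | rfl <;> rcases h j with rfl | rfl <;> simp [koszulSign, h2]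

theorem koszulSign_mul_self (i : ZMod 2) : koszulSign i * koszulSign i = 1 := by
  rw [← koszulSign_add, CharTwo.add_self_eq_zero, koszulSign_zero]

theorem koszulSign_add_one (i : ZMod 2) : koszulSign (i + 1) = -koszulSign i := by
  rw [koszulSign_add, koszulSign_one, mul_neg_one]

theorem koszulSign_smul_smul {E : Type*} [AddCommGroup E] [Module ℝ E] (i j : ZMod 2) (v : E) :
    koszulSign i • koszulSign j • v = koszulSign (i + j) • v := by
  rw [smul_smul, koszulSign_add]

/-! ### Supercommutative algebras and superderivations -/

section Superalgebra

variable {A : Type*} [Ring A] [Algebra ℝ A]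

/-- The submodules `G 0`, `G 1` make `A` a supercommutative superalgebra. -/
structure IsSupercommutative (G : ZMod 2 → Submodule ℝ A) : Prop where
  isCompl : IsCompl (G 0) (G 1)
  one_mem : (1 : A) ∈ G 0
  mul_mem : ∀ {i j : ZMod 2} {f g : A}, f ∈ G i → g ∈ G j → f * g ∈ G (i + j)
  mul_comm : ∀ {i j : ZMod 2} {f g : A}, f ∈ G i → g ∈ G j →
    f * g = koszulSign (i * j) • (g * f)

/-- `D` is a superderivation of parity `ε`. -/
structure IsSuperderivation (G : ZMod 2 → Submodule ℝ A) (ε : ZMod 2) (D : A →ₗ[ℝ] A) : Prop where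
  mem : ∀ {i : ZMod 2} {f : A}, f ∈ G i → D f ∈ G (ε + i)
  leibniz : ∀ {i : ZMod 2} {f : A}, f ∈ G i → ∀ g,
    D (f * g) = D f * g + koszulSign (ε * i) • (f * D g)

variable {G : ZMod 2 → Submodule ℝ A}

theorem IsSupercommutative.commute_of_mem_zero (hG : IsSupercommutative G) {f : A} (hf : f ∈ G 0)
    (g : A) : f * g = g * f := by
  have hg : g ∈ G 0 ⊔ G 1 := by rw [hG.isCompl.sup_eq_top]; trivial
  obtain ⟨a, ha, b, hb, rfl⟩ := Submodule.mem_sup.1 hg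
  rw [mul_add, add_mul, hG.mul_comm hf ha, hG.mul_comm hf hb]
  simp [koszulSign_zero]

theorem IsSupercommutative.exists_add (hG : IsSupercommutative G) (f : A) :
    ∃ a ∈ G 0, ∃ b ∈ G 1, a + b = f := by
  have hg : f ∈ G 0 ⊔ G 1 := by rw [hG.isCompl.sup_eq_top]; trivial
  exact Submodule.mem_sup.1 hg

theorem IsSupercommutative.induction (hG : IsSupercommutative G) {P : A → Prop}
    (hadd : ∀ a b, P a → P b → P (a + b)) (h : ∀ i, ∀ f ∈ G i, P f) (f : A) : P f := by
  obtain ⟨a, ha, b, hb, rfl⟩ := hG.exists_add f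
  exact hadd _ _ (h 0 a ha) (h 1 b hb)

theorem IsSuperderivation.leibniz_even {ε : ZMod 2} {D : A →ₗ[ℝ] A}
    (hD : IsSuperderivation G ε D) {f : A} (hf : f ∈ G 0) (g : A) :
    D (f * g) = D f * g + f * D g := by
  rw [hD.leibniz hf, mul_zero, koszulSign_zero, one_smul]

theorem IsSuperderivation.map_one (hG : IsSupercommutative G) {ε : ZMod 2} {D : A →ₗ[ℝ] A}
    (hD : IsSuperderivation G ε D) : D 1 = 0 := by
  have := hD.leibniz_even hG.one_mem 1
  simpa using this

/-- The supercommutator of two superderivations is a superderivation. -/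
theorem IsSuperderivation.bracket {ε η : ZMod 2} {X Y : A →ₗ[ℝ] A}
    (hX : IsSuperderivation G ε X) (hY : IsSuperderivation G η Y) :
    IsSuperderivation G (ε + η) (X ∘ₗ Y - koszulSign (ε * η) • Y ∘ₗ X) where
  mem {i f} hf := by
    refine Submodule.sub_mem _ ?_ (Submodule.smul_mem _ _ ?_)
    · have := hX.mem (hY.mem hf)
      rwa [← add_assoc] at this
    · have := hY.mem (hX.mem hf)
      rwa [← add_assoc, add_comm η ε] at this
  leibniz {i f} hf g := by
    -- Exponents of signs live in `ZMod 2`, so this and the later sign identities are finite checks,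
    -- left to `decide`.
    have e : ε * η + η * (ε + i) = η * i := by clear * -; decide +revert
    simp only [LinearMap.sub_apply, LinearMap.smul_apply, LinearMap.comp_apply, hX.leibniz hf,
      hY.leibniz hf, map_add, map_smul, hX.leibniz (hY.mem hf), hY.leibniz (hX.mem hf), smul_add,
      sub_mul, mul_sub, smul_sub, smul_mul_assoc, mul_smul_comm, koszulSign_smul_smul, e]
    rw [show ε * (η + i) = ε * η + ε * i by clear * -; decide +revert,
      show (ε + η) * i + ε * η = ε * η + (ε * i + η * i) by clear * -; decide +revert,
      show (ε + η) * i = η * i + ε * i by clear * -; decide +revert]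
    abel

/-! ### Coordinate frames and divergences -/

/-- Coordinates `x a` of parities `par a` and commuting superderivations `∂ a` of the same
parities. -/
structure IsCoordinateFrame {ι : Type*} (G : ZMod 2 → Submodule ℝ A) (par : ι → ZMod 2)
    (x : ι → A) (d : ι → A →ₗ[ℝ] A) : Prop where
  x_mem : ∀ a, x a ∈ G (par a)
  superderivation : ∀ a, IsSuperderivation G (par a) (d a)
  d_comm : ∀ a b f, d a (d b f) = koszulSign (par a * par b) • d b (d a f)

/-- The expression `∑ₐ (-1)^{ã (ε + 1)} ∂ₐ (ρ vᵃ)`. -/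
noncomputable def superDiv {ι : Type*} [Fintype ι] (par : ι → ZMod 2) (d : ι → A →ₗ[ℝ] A)
    (ρ : A) (ε : ZMod 2) (v : ι → A) : A :=
  ∑ a, koszulSign (par a * (ε + 1)) • d a (ρ * v a)

variable {ι : Type*} [Fintype ι] {par : ι → ZMod 2} {x : ι → A} {d : ι → A →ₗ[ℝ] A}

/-- Leibniz rule div(gX) = g div X ± ρ X(g). The weight (-1)^{ã(ε+1)} is exactly what makes the sign
of ∂_a passing g independent of a. When v consists of the components of a vector field X, the last
sum is X(g). -/
theorem superDiv_mul_left (hG : IsSupercommutative G) (h : IsCoordinateFrame G par x d)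
    {ρ g : A} (hρ : ρ ∈ G 0) {ε γ : ZMod 2} (hg : g ∈ G γ) {v : ι → A}
    (hv : ∀ a, v a ∈ G (ε + par a)) :
    superDiv par d ρ (γ + ε) (fun a => g * v a) =
      g * superDiv par d ρ ε v + koszulSign (γ * ε) • (ρ * ∑ a, v a * d a g) := by
  simp only [superDiv, Finset.mul_sum, Finset.smul_sum, ← Finset.sum_add_distrib]
  refine Finset.sum_congr rfl fun a _ => ?_
  rw [← mul_assoc, hG.commute_of_mem_zero hρ g, mul_assoc, (h.superderivation a).leibniz hg,
    hG.mul_comm ((h.superderivation a).mem hg) (hG.mul_mem hρ (hv a)), mul_assoc]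
  simp only [smul_add, mul_smul_comm, koszulSign_smul_smul]
  generalize par a = α
  rw [show α * (γ + ε + 1) + (α + γ) * (0 + (ε + α)) = γ * ε by clear * -; decide +revert,
    show α * (γ + ε + 1) + α * γ = α * (ε + 1) by clear * -; decide +revert, add_comm]

/-- The Leibniz rule for density 1 and factor ρ; it separates the coordinate divergence from the
derivative of ρ. -/
theorem superDiv_eq (hG : IsSupercommutative G) (h : IsCoordinateFrame G par x d)
    {ρ : A} (hρ : ρ ∈ G 0) {ε : ZMod 2} {v : ι → A} (hv : ∀ a, v a ∈ G (ε + par a)) :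
    superDiv par d ρ ε v =
      ρ * superDiv par d 1 ε v + ∑ a, v a * d a ρ := by
  have := superDiv_mul_left hG h hG.one_mem hρ hv
  simp only [zero_add, zero_mul, koszulSign_zero, one_smul, one_mul] at this
  rw [← this]
  simp [superDiv]

theorem superDiv_mem (hG : IsSupercommutative G) (h : IsCoordinateFrame G par x d)
    {ρ : A} (hρ : ρ ∈ G 0) {ε : ZMod 2} {v : ι → A} (hv : ∀ a, v a ∈ G (ε + par a)) :
    superDiv par d ρ ε v ∈ G ε := by
  refine Submodule.sum_mem _ fun a _ => Submodule.smul_mem _ _ ?_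
  have := (h.superderivation a).mem (hG.mul_mem hρ (hv a))
  rwa [show par a + (0 + (ε + par a)) = ε by
    generalize par a = α; clear * -; decide +revert] at this

/-- The coordinate divergence of a supercommutator. -/
theorem superDiv_one_bracket (hG : IsSupercommutative G) (h : IsCoordinateFrame G par x d)
    {ε η : ZMod 2} {X Y : A →ₗ[ℝ] A} (hX : IsSuperderivation G ε X)
    (hY : IsSuperderivation G η Y) (hXd : ∀ f, X f = ∑ a, X (x a) * d a f)
    (hYd : ∀ f, Y f = ∑ a, Y (x a) * d a f) :
    superDiv par d 1 (ε + η) (fun a => X (Y (x a)) - koszulSign (ε * η) • Y (X (x a))) =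
      X (superDiv par d 1 η (fun a => Y (x a))) -
        koszulSign (ε * η) • Y (superDiv par d 1 ε (fun a => X (x a))) := by
  -- Write X(Y x^a) as Σ_b X(x^b) ∂_b(Y x^a) and apply ∂_a. Where ∂_a reaches the second factor it
  -- commutes past ∂_b and the terms reassemble to X(div Y); what remains is quadratic in first
  -- derivatives.
  have key : ∀ {ε η : ZMod 2} {X Y : A →ₗ[ℝ] A}, IsSuperderivation G ε X →
      (∀ f, X f = ∑ a, X (x a) * d a f) →
      superDiv par d 1 (ε + η) (fun a => X (Y (x a))) =
        X (superDiv par d 1 η (fun a => Y (x a))) +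
        ∑ a, ∑ b, koszulSign (par a * (ε + η + 1)) • (d a (X (x b)) * d b (Y (x a))) := by
    intro ε η X Y hX hXd
    simp only [superDiv, one_mul, map_sum, map_smul, ← Finset.sum_add_distrib]
    refine Finset.sum_congr rfl fun a _ => ?_
    rw [hXd (Y (x a)), hXd (d a (Y (x a)))]
    simp only [map_sum, Finset.smul_sum, ← Finset.sum_add_distrib]
    refine Finset.sum_congr rfl fun b _ => ?_
    rw [(h.superderivation a).leibniz (hX.mem (h.x_mem b)), h.d_comm b a]
    simp only [smul_add, mul_smul_comm, koszulSign_smul_smul]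
    generalize par a = α
    generalize par b = β
    rw [show α * (ε + η + 1) + α * (ε + β) = α * (η + 1) + β * α by clear * -; decide +revert,
      add_comm]
  have e : superDiv par d 1 (ε + η) (fun a => X (Y (x a)) - koszulSign (ε * η) • Y (X (x a))) =
      superDiv par d 1 (ε + η) (fun a => X (Y (x a))) -
        koszulSign (ε * η) • superDiv par d 1 (η + ε) (fun a => Y (X (x a))) := by
    simp only [superDiv, one_mul, map_sub, map_smul, smul_sub, Finset.sum_sub_distrib,
      Finset.smul_sum, koszulSign_smul_smul, add_comm ε η]
    simp only [add_comm]
  rw [e, key hX hXd, key hY hYd, smul_add, add_sub_add_comm]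
  convert add_zero _
  -- The quadratic remainders for XY and YX agree after exchanging the summation indices and the two
  -- factors.
  rw [sub_eq_zero, Finset.sum_comm]
  simp only [Finset.smul_sum, koszulSign_smul_smul]
  refine Finset.sum_congr rfl fun a _ => Finset.sum_congr rfl fun b _ => ?_
  rw [hG.mul_comm ((h.superderivation b).mem (hX.mem (h.x_mem a)))
    ((h.superderivation a).mem (hY.mem (h.x_mem b))), koszulSign_smul_smul]
  congr 2
  generalize par a = α
  generalize par b = β
  clear * -; decide +revert

/-- The divergence of a supercommutator with respect to the volume `ρ`. -/
theorem superDiv_bracket (hG : IsSupercommutative G) (h : IsCoordinateFrame G par x d)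
    {ρ : A} (hρ : ρ ∈ G 0) (hu : IsUnit ρ)
    {ε η : ZMod 2} {X Y Z : A →ₗ[ℝ] A} (hX : IsSuperderivation G ε X)
    (hY : IsSuperderivation G η Y) (hXd : ∀ f, X f = ∑ a, X (x a) * d a f)
    (hYd : ∀ f, Y f = ∑ a, Y (x a) * d a f)
    (hZ : Z = X ∘ₗ Y - koszulSign (ε * η) • Y ∘ₗ X)
    (hZd : ∀ f, Z f = ∑ a, Z (x a) * d a f) {δX δY : A}
    (hδX : δX * ρ = superDiv par d ρ ε (fun a => X (x a)))
    (hδY : δY * ρ = superDiv par d ρ η (fun a => Y (x a))) :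
    superDiv par d ρ (ε + η) (fun a => Z (x a)) =
      (X δY - koszulSign (ε * η) • Y δX) * ρ := by
  have hZ' : IsSuperderivation G (ε + η) Z := hZ ▸ hX.bracket hY
  have hZa : ∀ f, Z f = X (Y f) - koszulSign (ε * η) • Y (X f) := fun f => by rw [hZ]; rfl
  have comm := hG.commute_of_mem_zero hρ
  have hXρ : ∑ a, X (x a) * d a ρ = X ρ := (hXd ρ).symm
  have hYρ : ∑ a, Y (x a) * d a ρ = Y ρ := (hYd ρ).symm
  rw [superDiv_eq hG h hρ (fun a => hX.mem (h.x_mem a)), hXρ, ← comm] at hδX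
  rw [superDiv_eq hG h hρ (fun a => hY.mem (h.x_mem a)), hYρ, ← comm] at hδY
  rw [superDiv_eq hG h hρ (fun a => hZ'.mem (h.x_mem a)), ← hZd ρ]
  simp only [hZa]
  rw [superDiv_one_bracket hG h hX hY hXd hYd, ← comm]
  generalize superDiv par d 1 ε (fun a => X (x a)) = sX at *
  generalize superDiv par d 1 η (fun a => Y (x a)) = sY at *
  have e1 := congrArg X hδY
  have e2 := congrArg Y hδX
  rw [map_add, hX.leibniz_even hρ, hX.leibniz_even hρ] at e1
  rw [map_add, hY.leibniz_even hρ, hY.leibniz_even hρ] at e2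
  have e3 : X ρ * Y ρ = koszulSign (ε * η) • (Y ρ * X ρ) := by
    simpa using hG.mul_comm (hX.mem hρ) (hY.mem hρ)
  have c1 : ρ * (X ρ * δY) = X ρ * (ρ * δY) := by rw [← mul_assoc, comm, mul_assoc]
  have c2 : ρ * (Y ρ * δX) = Y ρ * (ρ * δX) := by rw [← mul_assoc, comm, mul_assoc]
  have c3 : ρ * (X ρ * sY) = X ρ * (ρ * sY) := by rw [← mul_assoc, comm, mul_assoc]
  have c4 : ρ * (Y ρ * sX) = Y ρ * (ρ * sX) := by rw [← mul_assoc, comm, mul_assoc]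
  -- After multiplication by ρ, every undifferentiated δX and δY can be brought next to a factor ρ
  -- and eliminated by `hδX`, `hδY`. The leftover products Xρ·Yρ and Yρ·Xρ cancel by `e3`.
  apply hu.mul_left_cancel
  rw [← sub_eq_zero]
  have e1' : ρ * (ρ * X δY) = ρ * (X ρ * sY + ρ * X sY + X (Y ρ) - X ρ * δY) := by
    rw [← e1]; congr 1; abel
  have e2' : ρ * (ρ * Y δX) = ρ * (Y ρ * sX + ρ * Y sX + Y (X ρ) - Y ρ * δX) := by
    rw [← e2]; congr 1; abel
  simp only [mul_sub, mul_add, mul_smul_comm] at e1' e2' ⊢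
  rw [e1', e2', c1, c2, hδX, hδY, c3, c4]
  simp only [mul_add, smul_add, smul_sub, e3]
  abel

end Superalgebra

/-! ### Invariance of the divergence -/

section ChangeOfCoordinates

variable {A : Type*} [Ring A] [Algebra ℝ A] {G : ZMod 2 → Submodule ℝ A}
  {ι : Type*} [Fintype ι] [DecidableEq ι] {par : ι → ZMod 2} {x x' : ι → A} {d d' : ι → A →ₗ[ℝ] A}

/-- Invariance of the divergence under a change of coordinates, for a Jacobian `u` that satisfies
Liouville's formula. -/
theorem superDiv_change (hG : IsSupercommutative G) (h : IsCoordinateFrame G par x d)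
    (h' : IsCoordinateFrame G par x' d')
    (hd : ∀ b f, d' b f = ∑ c, d' b (x c) * d c f)
    (hJK : ∀ a c, ∑ b, d a (x' b) * d' b (x c) = if a = c then 1 else 0)
    {ρ u : A} (hρ : ρ ∈ G 0) (hu : u ∈ G 0)
    (hL : ∀ a, d a u = u * ∑ b, ∑ c,
      koszulSign (par b + par a * (par b + par c)) • (d' b (x c) * d a (d c (x' b))))
    {ε : ZMod 2} {v v' : ι → A} (hv : ∀ a, v a ∈ G (ε + par a))
    (hv' : ∀ b, v' b = ∑ a, v a * d a (x' b)) :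
    superDiv par d (ρ * u) ε v = u * superDiv par d' ρ ε v' := by
  have hL' : ∀ a, d a u = (∑ b, ∑ c,
      koszulSign (par b + par a * (par b + par c)) • (d' b (x c) * d a (d c (x' b)))) * u :=
    fun a => by rw [hL, hG.commute_of_mem_zero hu]
  -- One summand of the new divergence after the chain rule for ∂'_b. The first part contracts over
  -- b, by `hJK`, to the old divergence; the second is a summand of the logarithmic derivative of u
  -- in `hL`.
  have term : ∀ a b c, koszulSign (par b * (ε + 1)) •
      (d' b (x c) * d c (ρ * (v a * d a (x' b)))) =
      koszulSign (par a * (ε + 1)) • (d a (x' b) * d' b (x c) * d c (ρ * v a)) +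
      ρ * (v a * (koszulSign (par b + par a * (par b + par c)) •
        (d' b (x c) * d a (d c (x' b))))) := by
    intro a b c
    have hJ := (h.superderivation a).mem (h'.x_mem b)
    have hK := (h'.superderivation b).mem (h.x_mem c)
    have hva := hG.mul_mem hρ (hv a)
    have hdva := (h.superderivation c).mem hva
    have e1 : d' b (x c) * (d c (ρ * v a) * d a (x' b)) =
        koszulSign ((par b + par c + (par c + (0 + (ε + par a)))) * (par a + par b)) •
          (d a (x' b) * d' b (x c) * d c (ρ * v a)) := by
      rw [← mul_assoc, hG.mul_comm (hG.mul_mem hK hdva) hJ, mul_assoc (d a (x' b))]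
    have e2 : d' b (x c) * (ρ * v a * d c (d a (x' b))) =
        koszulSign ((par b + par c) * (0 + (ε + par a)) + par c * par a) •
          (ρ * (v a * (d' b (x c) * d a (d c (x' b))))) := by
      rw [h.d_comm c a, ← mul_assoc, hG.mul_comm hK hva]
      simp only [smul_mul_assoc, mul_smul_comm, koszulSign_smul_smul, mul_assoc]
      rw [add_comm (par c * par a)]
    rw [← mul_assoc ρ, (h.superderivation c).leibniz hva, mul_add (d' b (x c)), smul_add, e1,
      mul_smul_comm, e2]
    simp only [mul_smul_comm, koszulSign_smul_smul]
    generalize par a = α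
    generalize par b = β
    generalize par c = γ
    congr 3 <;> clear * - <;> decide +revert
  -- Passing to new coordinates without changing the density costs the logarithmic derivative of u
  -- along v; below, replacing ρ by ρu compensates it.
  have R : superDiv par d' ρ ε v' = superDiv par d ρ ε v +
      ρ * ∑ a, v a * ∑ b, ∑ c, koszulSign (par b + par a * (par b + par c)) •
        (d' b (x c) * d a (d c (x' b))) := by
    calc superDiv par d' ρ ε v' = ∑ b, ∑ c, ∑ a, koszulSign (par b * (ε + 1)) •
          (d' b (x c) * d c (ρ * (v a * d a (x' b)))) := by
          refine Finset.sum_congr rfl fun b _ => ?_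
          rw [hv', hd]
          simp only [Finset.smul_sum, Finset.mul_sum, map_sum]
      _ = ∑ a, ∑ c, ∑ b, koszulSign (par a * (ε + 1)) •
            (d a (x' b) * d' b (x c) * d c (ρ * v a)) +
          ∑ a, ∑ b, ∑ c, ρ * (v a * (koszulSign (par b + par a * (par b + par c)) •
            (d' b (x c) * d a (d c (x' b))))) := by
          simp only [term, Finset.sum_add_distrib]
          congr 1
          · refine (Finset.sum_congr rfl fun b _ => Finset.sum_comm).trans
              (Finset.sum_comm.trans ?_)
            exact Finset.sum_congr rfl fun a _ => Finset.sum_comm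
          · exact (Finset.sum_congr rfl fun b _ => Finset.sum_comm).trans Finset.sum_comm
      _ = _ := by
          simp only [Finset.mul_sum]
          congr 1
          refine Finset.sum_congr rfl fun a _ => ?_
          simp only [← Finset.smul_sum, ← Finset.sum_mul, hJK, ite_mul, one_mul, zero_mul]
          simp
  rw [R, superDiv_eq hG h (hG.mul_mem hρ hu) hv, superDiv_eq hG h hρ hv]
  have e : ∀ a, v a * d a (ρ * u) = (v a * d a ρ + ρ * (v a * ∑ b, ∑ c,
      koszulSign (par b + par a * (par b + par c)) • (d' b (x c) * d a (d c (x' b))))) * u := by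
    intro a
    rw [(h.superderivation a).leibniz_even hρ u, hL', mul_add, add_mul, ← mul_assoc, ← mul_assoc ρ,
      ← mul_assoc, ← mul_assoc, ← hG.commute_of_mem_zero hρ]
    simp only [mul_assoc]
  rw [Finset.sum_congr rfl fun a _ => e a, ← Finset.sum_mul, Finset.sum_add_distrib,
    ← Finset.mul_sum, hG.commute_of_mem_zero hu, add_assoc, add_mul _ _ u, mul_assoc ρ u,
    hG.commute_of_mem_zero hu, ← mul_assoc]
  simp only [add_mul]

end ChangeOfCoordinates

/-! ### Derivatives of determinants -/

section JacobiFormula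

variable {R A : Type*} [CommRing R] [Ring A] (f : R →+* A) (δ : R →+ A)

/-- Determinants are formed in the commutative ring R of even functions, but an odd derivation
leaves that ring. Hence δ takes values in the larger algebra A and is a derivation along f, whose
values are central. -/
theorem map_prod_of_leibniz (hf : ∀ a b, f a * b = b * f a)
    (hδ : ∀ a b, δ (a * b) = δ a * f b + f a * δ b) {ι : Type*} [DecidableEq ι] (s : Finset ι)
    (g : ι → R) : δ (∏ i ∈ s, g i) = ∑ i ∈ s, f (∏ j ∈ s.erase i, g j) * δ (g i) := by
  induction s using Finset.induction_on with
  | empty =>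
    have := hδ 1 1
    simpa using this
  | insert a s ha ih =>
    rw [Finset.prod_insert ha, hδ, ih, Finset.sum_insert ha, Finset.erase_insert ha, ← hf,
      Finset.mul_sum]
    congr 1
    refine Finset.sum_congr rfl fun i hi => ?_
    have hai : a ≠ i := fun h => ha (h ▸ hi)
    rw [Finset.erase_insert_of_ne hai, Finset.prod_insert (by simp [ha]), map_mul, mul_assoc]

/-- Jacobi's formula for the derivative of a determinant. -/
theorem map_det_of_leibniz (hf : ∀ a b, f a * b = b * f a)
    (hδ : ∀ a b, δ (a * b) = δ a * f b + f a * δ b) {n : Type*} [Fintype n] [DecidableEq n]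
    (M : Matrix n n R) :
    δ M.det = ∑ i, ∑ j, f (M.adjugate i j) * δ (M j i) := by
  have hneg : ∀ (σ : Equiv.Perm n) a, δ (Equiv.Perm.sign σ • a) = Equiv.Perm.sign σ • δ a := by
    intro σ a
    rcases Int.units_eq_one_or (Equiv.Perm.sign σ) with h | h <;> simp [h]
  -- The cofactor as a sum over permutations with σ i = j, the shape in which the product rule for
  -- the determinant delivers it.
  have hadj : ∀ i j, M.adjugate i j = ∑ σ : Equiv.Perm n, if σ i = j then
      Equiv.Perm.sign σ • ∏ k ∈ Finset.univ.erase i, M (σ k) k else 0 := by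
    intro i j
    rw [Matrix.adjugate_apply, Matrix.det_apply]
    refine Finset.sum_congr rfl fun σ _ => ?_
    split_ifs with h
    · rw [← Finset.mul_prod_erase _ _ (Finset.mem_univ i), h, Matrix.updateRow_self,
        Pi.single_eq_same, one_mul]
      congr 1
      refine Finset.prod_congr rfl fun k hk => ?_
      rw [Matrix.updateRow_ne]
      intro hk'
      exact (Finset.mem_erase.1 hk).1 (σ.injective (hk'.trans h.symm))
    · rw [Finset.prod_eq_zero (Finset.mem_univ (σ.symm j)), smul_zero]
      rw [Equiv.apply_symm_apply, Matrix.updateRow_self, Pi.single_eq_of_ne]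
      rintro rfl
      exact h (σ.apply_symm_apply j)
  rw [Matrix.det_apply, map_sum]
  simp only [hneg, map_prod_of_leibniz f δ hf hδ, hadj, map_sum, Finset.sum_mul,
    Finset.smul_sum]
  rw [Finset.sum_comm]
  refine Finset.sum_congr rfl fun i _ => ?_
  rw [Finset.sum_comm]
  refine Finset.sum_congr rfl fun σ _ => ?_
  simp [apply_ite f, ite_mul, Units.smul_def, mul_assoc]

/-- Jacobi's formula for an invertible matrix. -/
theorem map_det_of_leibniz_of_isUnit (hf : ∀ a b, f a * b = b * f a)
    (hδ : ∀ a b, δ (a * b) = δ a * f b + f a * δ b) {n : Type*} [Fintype n] [DecidableEq n]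
    (M N : Matrix n n R) (hMN : N * M = 1) :
    δ M.det = f M.det * (N.map f * M.map δ).trace := by
  have : M.adjugate = M.det • N := by
    rw [← one_mul M.adjugate, ← hMN, Matrix.mul_assoc, Matrix.mul_adjugate, Matrix.mul_smul, mul_one]
  rw [map_det_of_leibniz f δ hf hδ, this]
  simp [Matrix.trace, Matrix.mul_apply, Finset.mul_sum, mul_assoc]

end JacobiFormula

/-! ### The logarithmic derivative of the Berezinian in block form -/

section Liouville

variable {A : Type*} [Ring A] [Algebra ℝ A] {G : ZMod 2 → Submodule ℝ A}

theorem IsSupercommutative.trace_mul_comm (hG : IsSupercommutative G) {m n : Type*} [Fintype m]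
    [Fintype n] {i j : ZMod 2} {M : Matrix m n A} {N : Matrix n m A} (hM : ∀ a b, M a b ∈ G i)
    (hN : ∀ a b, N a b ∈ G j) : (M * N).trace = koszulSign (i * j) • (N * M).trace := by
  simp only [Matrix.trace, Matrix.diag_apply, Matrix.mul_apply, Finset.smul_sum]
  rw [Finset.sum_comm]
  exact Finset.sum_congr rfl fun b _ => Finset.sum_congr rfl fun a _ =>
    hG.mul_comm (hM a b) (hN b a)

theorem IsSuperderivation.map_matrix_mul {ε : ZMod 2} {D : A →ₗ[ℝ] A}
    (hD : IsSuperderivation G ε D) {l m n : Type*} [Fintype m] {i : ZMod 2} {M : Matrix l m A}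
    (hM : ∀ a b, M a b ∈ G i) (N : Matrix m n A) :
    (M * N).map D = M.map D * N + koszulSign (ε * i) • (M * N.map D) := by
  ext a b
  simp only [Matrix.map_apply, Matrix.mul_apply, map_sum, Matrix.add_apply, Matrix.smul_apply,
    Finset.smul_sum, ← Finset.sum_add_distrib]
  exact Finset.sum_congr rfl fun c _ => hD.leibniz (hM a c) _

theorem IsSupercommutative.matrix_mul_mem (hG : IsSupercommutative G) {l m n : Type*} [Fintype m]
    {i j : ZMod 2} {M : Matrix l m A} {N : Matrix m n A} (hM : ∀ a b, M a b ∈ G i)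
    (hN : ∀ a b, N a b ∈ G j) (a : l) (b : n) : (M * N) a b ∈ G (i + j) := by
  rw [Matrix.mul_apply]
  exact Submodule.sum_mem _ fun c _ => hG.mul_mem (hM a c) (hN c b)

/-- The logarithmic derivative of the Berezinian, in terms of the blocks `A₁₁`, `A₁₂`, `A₂₁`, `A₂₂`
of a matrix, of the inverse `E` of `A₂₂`, and of the blocks of the inverse matrix. -/
theorem trace_schur_complement (hG : IsSupercommutative G) {ε : ZMod 2} {D : A →ₗ[ℝ] A}
    (hD : IsSuperderivation G ε D) {m n : Type*} [Fintype m] [Fintype n] [DecidableEq m]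
    [DecidableEq n] {A₁₁ K₁₁ T : Matrix m m A} {A₁₂ K₁₂ : Matrix m n A} {A₂₁ K₂₁ : Matrix n m A}
    {A₂₂ K₂₂ E : Matrix n n A}
    (h₁₂ : ∀ a b, A₁₂ a b ∈ G 1) (h₂₁ : ∀ a b, A₂₁ a b ∈ G 1) (h₂₂ : ∀ a b, A₂₂ a b ∈ G 0)
    (hE : ∀ a b, E a b ∈ G 0) (hT : ∀ a b, T a b ∈ G 0)
    (hE1 : A₂₂ * E = 1) (hE2 : E * A₂₂ = 1) (hT1 : (A₁₁ - A₁₂ * E * A₂₁) * T = 1)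
    (hK₁₁ : K₁₁ * A₁₁ + K₁₂ * A₂₁ = 1) (hK₁₂ : K₁₁ * A₁₂ + K₁₂ * A₂₂ = 0)
    (hK₂₁ : K₂₁ * A₁₁ + K₂₂ * A₂₁ = 0) (hK₂₂ : K₂₁ * A₁₂ + K₂₂ * A₂₂ = 1) :
    (T * (A₁₁ - A₁₂ * E * A₂₁).map D).trace + (A₂₂ * E.map D).trace =
      (K₁₁ * A₁₁.map D).trace + koszulSign ε • (K₁₂ * A₂₁.map D).trace -
        koszulSign ε • (K₂₁ * A₁₂.map D).trace - (K₂₂ * A₂₂.map D).trace := by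
  -- Block inversion: the blocks of the inverse matrix are expressed through E and through the
  -- inverse T of the Schur complement.
  have k₁₂ : K₁₂ = -(K₁₁ * A₁₂ * E) := by
    rw [eq_neg_of_add_eq_zero_left hK₁₂, Matrix.neg_mul, neg_neg, Matrix.mul_assoc, hE1, Matrix.mul_one]
  have k₁₁ : K₁₁ = T := by
    have : K₁₁ * (A₁₁ - A₁₂ * E * A₂₁) = 1 := by
      rw [← hK₁₁, k₁₂]
      simp [Matrix.mul_add, Matrix.mul_assoc, sub_eq_add_neg]
    rw [← Matrix.mul_one K₁₁, ← hT1, ← Matrix.mul_assoc, this, Matrix.one_mul]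
  have k₂₂ : K₂₂ = E - K₂₁ * A₁₂ * E := by
    have := congrArg (· * E) hK₂₂
    simp only [Matrix.add_mul, Matrix.one_mul, Matrix.mul_assoc, hE1, Matrix.mul_one] at this
    rw [Matrix.mul_assoc, eq_sub_iff_add_eq, add_comm]
    exact this
  have k₂₁ : K₂₁ = -(E * A₂₁ * T) := by
    have : K₂₁ * (A₁₁ - A₁₂ * E * A₂₁) = -(E * A₂₁) := by
      rw [← sub_eq_zero, ← hK₂₁, k₂₂]
      simp [Matrix.mul_sub, Matrix.sub_mul, Matrix.mul_assoc]
      abel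
    rw [← Matrix.mul_one K₂₁, ← hT1, ← Matrix.mul_assoc, this, Matrix.neg_mul]
  subst k₁₁
  have d₁₂ : ∀ a b, A₁₂.map D a b ∈ G (ε + 1) := fun a b => hD.mem (h₁₂ a b)
  have d₂₁ : ∀ a b, A₂₁.map D a b ∈ G (ε + 1) := fun a b => hD.mem (h₂₁ a b)
  have dE : ∀ a b, E.map D a b ∈ G (ε + 0) := fun a b => hD.mem (hE a b)
  have dA : ∀ a b, A₂₂.map D a b ∈ G (ε + 0) := fun a b => hD.mem (h₂₂ a b)
  have dEe : E.map D = -(E * A₂₂.map D * E) := by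
    have := hD.map_matrix_mul hE A₂₂
    rw [hE2, mul_zero, koszulSign_zero, one_smul] at this
    have z : (1 : Matrix n n A).map D = 0 := by
      ext a b
      by_cases h : a = b <;> simp [h, hD.map_one hG]
    rw [z] at this
    have := congrArg (· * E) this
    simp only [Matrix.add_mul, Matrix.zero_mul, Matrix.mul_assoc, hE1, Matrix.mul_one] at this
    rw [eq_comm, add_comm] at this
    rw [eq_neg_of_add_eq_zero_right this]
    simp only [Matrix.mul_assoc]
  have dS : (A₁₁ - A₁₂ * E * A₂₁).map D = A₁₁.map D - A₁₂.map D * E * A₂₁ -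
      koszulSign ε • (A₁₂ * E.map D * A₂₁) - koszulSign ε • (A₁₂ * E * A₂₁.map D) := by
    rw [Matrix.map_sub _ (fun a b => map_sub D a b),
      hD.map_matrix_mul (hG.matrix_mul_mem h₁₂ hE), hD.map_matrix_mul h₁₂]
    simp [Matrix.add_mul]
    abel
  rw [dS]
  simp only [Matrix.mul_sub, Matrix.trace_sub, Matrix.mul_smul, Matrix.trace_smul]
  -- Graded cyclicity of the trace sorts the terms by the differentiated block: `t₁` gives the K₂₁
  -- term, while `t₃` and `t₄` give the two parts of K₂₂ = E + E A₂₁ T A₁₂ E.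
  have t₁ : (K₁₁ * (A₁₂.map D * E * A₂₁)).trace = koszulSign ε • (K₂₁ * A₁₂.map D).trace := by
    have := hG.trace_mul_comm (hG.matrix_mul_mem hT d₁₂) (hG.matrix_mul_mem hE h₂₁)
    rw [show (0 + (ε + 1)) * (0 + 1) = ε + 1 by clear * -; decide +revert,
      koszulSign_add_one, neg_smul] at this
    simp only [Matrix.mul_assoc] at this ⊢
    rw [this, k₂₁]
    simp [Matrix.mul_assoc]
  have t₃ : koszulSign ε • (K₁₁ * (A₁₂ * E.map D * A₂₁)).trace =
      (E * A₂₁ * K₁₁ * A₁₂ * E * A₂₂.map D).trace := by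
    have := hG.trace_mul_comm (hG.matrix_mul_mem (hG.matrix_mul_mem (hG.matrix_mul_mem hT h₁₂) hE)
      dA) (hG.matrix_mul_mem hE h₂₁)
    rw [show (0 + 1 + 0 + (ε + 0)) * (0 + 1) = ε + 1 by clear * -; decide +revert,
      koszulSign_add_one, neg_smul] at this
    rw [dEe]
    simp only [Matrix.mul_assoc, Matrix.mul_neg, Matrix.neg_mul, Matrix.trace_neg, smul_neg]
      at this ⊢
    rw [this, smul_neg, neg_neg, smul_smul, koszulSign_mul_self, one_smul]
  have t₄ : (A₂₂ * E.map D).trace = -(E * A₂₂.map D).trace := by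
    have := hG.trace_mul_comm dA hE
    rw [mul_zero, koszulSign_zero, one_smul] at this
    rw [dEe, ← this]
    simp only [Matrix.mul_neg, Matrix.trace_neg, ← Matrix.mul_assoc, hE1, Matrix.one_mul]
  rw [t₁, t₃, t₄, k₂₂, k₁₂, k₂₁]
  simp only [Matrix.mul_assoc, Matrix.neg_mul, Matrix.trace_neg, smul_neg, Matrix.sub_mul,
    Matrix.trace_sub]
  abel

end Liouville

/-! ### Liouville's formula for the Berezinian -/

namespace SuperSpace

theorem isSupercommutative (X : SuperSpace.{u}) (V : Opens X.carrier) :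
    IsSupercommutative (A := X.sec V) (X.gr V) where
  isCompl := X.gr_isCompl V
  one_mem := X.one_mem_gr V
  mul_mem hf hg := X.mul_mem_gr V _ _ _ hf _ hg
  mul_comm hf hg := X.mul_comm_gr V _ _ _ hf _ hg

variable (X : SuperSpace.{u}) (V : Opens X.carrier)

theorem evenProj_of_mem {f : X.sec V} (hf : f ∈ X.gr V 0) : (X.evenProj V f : X.sec V) = f :=
  congrArg Subtype.val (Submodule.projectionOnto_apply_left (X.gr_isCompl V) (⟨f, hf⟩ : X.gr V 0))

/-- The inclusion of the even functions. -/
def evenIncl : X.evenPart V →+* X.sec V where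
  toFun a := a
  map_one' := rfl
  map_mul' _ _ := rfl
  map_zero' := rfl
  map_add' _ _ := rfl

/-- The even part b₀ of an inverse is already an inverse: a b₁ = 1 - a b₀ is both odd and even,
hence zero. This transfers invertibility to the commutative ring in which the determinants live. -/
theorem isUnit_evenPart {a : X.evenPart V} (ha : IsUnit (a : X.sec V)) : IsUnit a := by
  obtain ⟨b, hb⟩ := ha.exists_right_inv
  have hG := X.isSupercommutative V
  obtain ⟨b₀, h₀, b₁, h₁, rfl⟩ := hG.exists_add b
  have h : (a : X.sec V) * b₁ = 1 - a * b₀ := by rw [← hb]; noncomm_ring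
  have m1 := hG.mul_mem a.2 h₁
  have m0 : (1 : X.sec V) - a * b₀ ∈ X.gr V 0 :=
    Submodule.sub_mem _ hG.one_mem (hG.mul_mem a.2 h₀)
  have z : (a : X.sec V) * b₁ = 0 :=
    Submodule.disjoint_def.1 hG.isCompl.disjoint _ (h ▸ m0) m1
  refine IsUnit.of_mul_eq_one (⟨b₀, h₀⟩ : X.evenPart V) (Subtype.ext ?_)
  change (a : X.sec V) * b₀ = 1
  rw [← sub_eq_zero, ← neg_eq_zero, neg_sub, ← h, z]

/-- Liouville's formula for the derivative of a Berezinian. -/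
theorem berezinian_liouville {p q : ℕ} {V : Opens X.carrier}
    {J K : Matrix (Fin p ⊕ Fin q) (Fin p ⊕ Fin q) (X.sec V)}
    (hJ : ∀ a b, J a b ∈ X.gr V (coordParity a + coordParity b)) (hKJ : K * J = 1)
    (hu : IsUnit (X.berezinian V J : X.sec V)) {ε : ZMod 2} {D : X.sec V →ₗ[ℝ] X.sec V}
    (hD : IsSuperderivation (X.gr V) ε D) :
    D (X.berezinian V J) = X.berezinian V J * ∑ b, ∑ c,
      koszulSign (coordParity b + ε * (coordParity b + coordParity c)) • (K b c * D (J c b)) := by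
  have hG := X.isSupercommutative V
  set f := X.evenIncl V with hf
  let δ : X.evenPart V →+ X.sec V := D.toAddMonoidHom.comp f.toAddMonoidHom
  have hfc : ∀ a b, f a * b = b * f a := fun a b => hG.commute_of_mem_zero a.2 b
  have hδ : ∀ a b, δ (a * b) = δ a * f b + f a * δ b := fun a b => hD.leibniz_even a.2 b
  obtain ⟨D₂, hD₂⟩ : ∃ D₂, D₂ = J.toBlocks₂₂.map (X.evenProj V) := ⟨_, rfl⟩
  obtain ⟨S, hS⟩ : ∃ S, S = (J.toBlocks₁₁ - J.toBlocks₁₂ * (D₂⁻¹).map (fun a => (a : X.sec V)) *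
    J.toBlocks₂₁).map (X.evenProj V) := ⟨_, rfl⟩
  have hB : X.berezinian V J = S.det * (D₂⁻¹).det := by rw [hS, hD₂]; rfl
  have hBu := X.isUnit_evenPart V hu
  rw [hB] at hBu
  have hSu := isUnit_of_mul_isUnit_left hBu
  -- The conventional value of `D₂⁻¹` at a singular matrix does no harm: a unit Berezinian forces
  -- both of its factors to be units, and with them `det D₂`.
  have hDu := Matrix.isUnit_nonsing_inv_det_iff.1 (isUnit_of_mul_isUnit_right hBu)
  have b₁₁ : ∀ a b, J.toBlocks₁₁ a b ∈ X.gr V 0 := fun a b => by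
    have := hJ (Sum.inl a) (Sum.inl b)
    simp only [coordParity, Sum.elim_inl, add_zero] at this
    exact this
  have b₁₂ : ∀ a b, J.toBlocks₁₂ a b ∈ X.gr V 1 := fun a b => by
    have := hJ (Sum.inl a) (Sum.inr b)
    simp only [coordParity, Sum.elim_inl, Sum.elim_inr, zero_add] at this
    exact this
  have b₂₁ : ∀ a b, J.toBlocks₂₁ a b ∈ X.gr V 1 := fun a b => by
    have := hJ (Sum.inr a) (Sum.inl b)
    simp only [coordParity, Sum.elim_inl, Sum.elim_inr, add_zero] at this
    exact this
  have b₂₂ : ∀ a b, J.toBlocks₂₂ a b ∈ X.gr V 0 := fun a b => by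
    have := hJ (Sum.inr a) (Sum.inr b)
    simp only [coordParity, Sum.elim_inr, CharTwo.add_self_eq_zero] at this
    exact this
  have mD : D₂.map f = J.toBlocks₂₂ := by
    ext a b; rw [hD₂]; exact X.evenProj_of_mem V (b₂₂ a b)
  set E := (D₂⁻¹).map f with hE
  have hEm : ∀ a b, E a b ∈ X.gr V 0 := fun a b => (D₂⁻¹ a b).2
  have mS : S.map f = J.toBlocks₁₁ - J.toBlocks₁₂ * E * J.toBlocks₂₁ := by
    ext a b; rw [hS]; refine X.evenProj_of_mem V ?_
    refine Submodule.sub_mem _ (b₁₁ a b) ?_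
    have := hG.matrix_mul_mem (hG.matrix_mul_mem b₁₂ hEm) b₂₁ a b
    rwa [show (1 + 0 + 1 : ZMod 2) = 0 by decide] at this
  have fmul : ∀ {n : ℕ} (M N : Matrix (Fin n) (Fin n) (X.evenPart V)), M * N = 1 →
      M.map f * N.map f = 1 := by
    intro n M N h
    rw [← Matrix.map_mul, h]
    exact Matrix.map_one _ f.map_zero f.map_one
  have jS := map_det_of_leibniz_of_isUnit f δ hfc hδ S S⁻¹ (Matrix.nonsing_inv_mul _ hSu)
  have jD := map_det_of_leibniz_of_isUnit f δ hfc hδ D₂⁻¹ D₂ (Matrix.mul_nonsing_inv _ hDu)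
  have e1 : S.map δ = (J.toBlocks₁₁ - J.toBlocks₁₂ * E * J.toBlocks₂₁).map D := by
    rw [← mS]; rfl
  have e2 : D₂⁻¹.map δ = E.map D := rfl
  have hB' : D (X.berezinian V J) = X.berezinian V J *
      ((S⁻¹.map f * S.map δ).trace + (D₂.map f * D₂⁻¹.map δ).trace) := by
    have h1 : D (X.berezinian V J) = δ (S.det * (D₂⁻¹).det) := by rw [hB]; rfl
    have h2 : (X.berezinian V J : X.sec V) = f S.det * f (D₂⁻¹).det := by rw [hB]; rfl
    rw [h1, hδ, jS, jD, h2, mul_add, ← hfc (D₂⁻¹).det, ← mul_assoc, ← hfc S.det, mul_assoc,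
      ← mul_assoc (f S.det), ← mul_assoc (f S.det)]
  have hK : Matrix.fromBlocks K.toBlocks₁₁ K.toBlocks₁₂ K.toBlocks₂₁ K.toBlocks₂₂ *
      Matrix.fromBlocks J.toBlocks₁₁ J.toBlocks₁₂ J.toBlocks₂₁ J.toBlocks₂₂ = 1 := by
    rw [Matrix.fromBlocks_toBlocks, Matrix.fromBlocks_toBlocks, hKJ]
  rw [Matrix.fromBlocks_multiply, ← Matrix.fromBlocks_one, Matrix.fromBlocks_inj] at hK
  obtain ⟨k₁, k₂, k₃, k₄⟩ := hK
  have hT1 : (J.toBlocks₁₁ - J.toBlocks₁₂ * E * J.toBlocks₂₁) * S⁻¹.map f = 1 := by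
    rw [← mS]; exact fmul _ _ (Matrix.mul_nonsing_inv _ hSu)
  have hE1 : J.toBlocks₂₂ * E = 1 := by
    rw [← mD]; exact fmul _ _ (Matrix.mul_nonsing_inv _ hDu)
  have hE2 : E * J.toBlocks₂₂ = 1 := by
    rw [← mD]; exact fmul _ _ (Matrix.nonsing_inv_mul _ hDu)
  rw [hB', e1, e2, mD, trace_schur_complement (T := S⁻¹.map f) hG hD b₁₂ b₂₁ b₂₂ hEm (fun a b => (S⁻¹ a b).2)
    hE1 hE2 hT1 k₁ k₂ k₃ k₄]
  congr 1
  simp only [Fintype.sum_sum_type, coordParity, Sum.elim_inl, Sum.elim_inr, add_zero, mul_zero,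
    koszulSign_zero, one_smul, zero_add, mul_one, CharTwo.add_self_eq_zero,
    koszulSign_one, neg_smul, koszulSign_add, neg_mul, one_mul]
  simp only [Matrix.trace, Matrix.diag_apply, Matrix.mul_apply, Finset.sum_add_distrib,
    Finset.sum_neg_distrib, Finset.smul_sum, Matrix.map_apply]
  simp only [Matrix.toBlocks₁₁, Matrix.toBlocks₁₂, Matrix.toBlocks₂₁, Matrix.toBlocks₂₂,
    Matrix.of_apply]
  abel

end SuperSpace

/-! ### Grassmann algebras -/

section Grassmann

variable {q : ℕ} {R A : Type*} [CommRing R] [Algebra ℝ R] [Ring A]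

/-- The product of the `τ i`, `i ∈ I`, in increasing order. -/
def oddMonomial (τ : Fin q → A) (I : Finset (Fin q)) : A := (I.sort.map τ).prod

theorem oddMonomial_empty (τ : Fin q → A) : oddMonomial τ ∅ = 1 := by simp [oddMonomial]

theorem oddMonomial_singleton (τ : Fin q → A) (j : Fin q) : oddMonomial τ {j} = τ j := by
  simp [oddMonomial]

theorem oddMonomial_insert_of_lt (τ : Fin q → A) {j : Fin q} {I : Finset (Fin q)}
    (h : ∀ i ∈ I, j < i) : oddMonomial τ (insert j I) = τ j * oddMonomial τ I := by
  rw [oddMonomial, Finset.sort_insert _ (fun b hb => (h b hb).le) (fun hj => lt_irrefl _ (h j hj))]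
  simp [oddMonomial]

variable [Algebra ℝ A]

/-- The sign counts the generators of I below k, past which τ k has to move. Adding the smallest
element first in the induction peels factors off the left end. -/
theorem mul_oddMonomial {τ : Fin q → A} (hτ : ∀ i j, τ i * τ j = -(τ j * τ i)) (k : Fin q)
    (I : Finset (Fin q)) : τ k * oddMonomial τ I =
      if k ∈ I then 0 else (-1 : ℝ) ^ (I.filter (· < k)).card • oddMonomial τ (insert k I) := by
  have hsq : ∀ i, τ i * τ i = 0 := fun i => by
    -- Anticommutation only yields 2τ² = 0; real scalars allow division by 2.
    have h : (2 : ℝ) • (τ i * τ i) = 0 := by rw [two_smul]; nth_rewrite 1 [hτ i i]; simp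
    exact (smul_eq_zero.1 h).resolve_left two_ne_zero
  induction I using Finset.induction_on_min with
  | empty => simp [oddMonomial_empty, oddMonomial_singleton]
  | insert m I hm ih =>
    rcases lt_trichotomy k m with hk | rfl | hk
    · have h1 : ∀ i ∈ insert m I, k < i := by
        intro i hi
        rcases Finset.mem_insert.1 hi with rfl | hi
        exacts [hk, hk.trans (hm i hi)]
      have h2 : (insert m I).filter (· < k) = ∅ :=
        Finset.filter_eq_empty_iff.2 fun i hi => (h1 i hi).le.not_gt
      rw [if_neg (fun h => lt_irrefl _ (h1 k h)), h2, oddMonomial_insert_of_lt τ h1]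
      simp
    · rw [if_pos (Finset.mem_insert_self _ _), oddMonomial_insert_of_lt τ hm, ← mul_assoc, hsq,
        zero_mul]
    · have hmI : m ∉ I := fun h => lt_irrefl _ (hm m h)
      rw [oddMonomial_insert_of_lt τ hm, ← mul_assoc, hτ, neg_mul, mul_assoc, ih]
      by_cases hkI : k ∈ I
      · simp [hkI]
      · rw [if_neg hkI, if_neg (by simp [hkI, hk.ne']), Finset.filter_insert, if_pos hk,
          Finset.card_insert_of_notMem (by simp [hmI]), Finset.insert_comm k m,
          oddMonomial_insert_of_lt τ (j := m) (I := insert k I)]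
        · rw [pow_succ]; simp
        · intro i hi
          rcases Finset.mem_insert.1 hi with rfl | hi
          exacts [hk, hm i hi]

/-- The scalar is irrelevant for the even derivatives, which only touch coefficients; it suffices
that a word is a real multiple of one monomial. -/
theorem exists_list_prod_mul_oddMonomial {τ : Fin q → A} (hτ : ∀ i j, τ i * τ j = -(τ j * τ i))
    (l : List (Fin q)) (J : Finset (Fin q)) :
    ∃ (r : ℝ) (K : Finset (Fin q)), (l.map τ).prod * oddMonomial τ J = r • oddMonomial τ K := by
  induction l with
  | nil => exact ⟨1, J, by simp⟩
  | cons k l ih =>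
    obtain ⟨r, K, h⟩ := ih
    rw [List.map_cons, List.prod_cons, mul_assoc, h, mul_smul_comm, mul_oddMonomial hτ]
    split_ifs
    · exact ⟨0, K, by simp⟩
    · exact ⟨_, _, smul_smul _ _ _⟩

/-- The elements of `A` have unique expansions `∑_I P (f_I) τ^I` with anticommuting `τ i`. -/
structure IsGrassmann (G : ZMod 2 → Submodule ℝ A) (P : R →ₐ[ℝ] A) (τ : Fin q → A) : Prop where
  isSupercommutative : IsSupercommutative G
  map_mem : ∀ f, P f ∈ G 0
  odd_mem : ∀ j, τ j ∈ G 1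
  bijective : Function.Bijective
    (fun f : Finset (Fin q) → R => ∑ I, P (f I) * oddMonomial τ I)

namespace IsGrassmann

variable {G : ZMod 2 → Submodule ℝ A} {P : R →ₐ[ℝ] A} {τ : Fin q → A}

/-- The element with given coefficients. -/
noncomputable def ofCoeff (P : R →ₐ[ℝ] A) (τ : Fin q → A) : (Finset (Fin q) → R) →ₗ[ℝ] A where
  toFun f := ∑ I, P (f I) * oddMonomial τ I
  map_add' f g := by simp [add_mul, Finset.sum_add_distrib]
  map_smul' r f := by simp [Finset.smul_sum]

/-- The coefficients of an element. -/
noncomputable def coeff (h : IsGrassmann G P τ) : A ≃ₗ[ℝ] (Finset (Fin q) → R) :=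
  (LinearEquiv.ofBijective (ofCoeff P τ) h.bijective).symm

theorem anticomm (h : IsGrassmann G P τ) (i j : Fin q) : τ i * τ j = -(τ j * τ i) := by
  have := h.isSupercommutative.mul_comm (h.odd_mem i) (h.odd_mem j)
  rwa [mul_one, koszulSign_one, neg_one_smul] at this

theorem central (h : IsGrassmann G P τ) (f : R) (a : A) : P f * a = a * P f :=
  h.isSupercommutative.commute_of_mem_zero (h.map_mem f) a

theorem coeff_sum (h : IsGrassmann G P τ) (f : Finset (Fin q) → R) :
    h.coeff (∑ I, P (f I) * oddMonomial τ I) = f :=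
  LinearEquiv.symm_apply_apply (LinearEquiv.ofBijective (ofCoeff P τ) h.bijective) f

theorem sum_coeff (h : IsGrassmann G P τ) (a : A) :
    ∑ I, P (h.coeff a I) * oddMonomial τ I = a :=
  LinearEquiv.apply_symm_apply (LinearEquiv.ofBijective (ofCoeff P τ) h.bijective) a

theorem coeff_monomial (h : IsGrassmann G P τ) (f : R) (I : Finset (Fin q)) :
    h.coeff (P f * oddMonomial τ I) = Pi.single I f := by
  rw [← h.coeff_sum (Pi.single I f)]
  congr 1
  rw [Finset.sum_eq_single I (fun J _ hJ => by simp [hJ]) (by simp)]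
  simp

theorem coeff_map_mul (h : IsGrassmann G P τ) (f : R) (a : A) (I : Finset (Fin q)) :
    h.coeff (P f * a) I = f * h.coeff a I := by
  conv_lhs => rw [← h.sum_coeff a]
  simp only [Finset.mul_sum, ← mul_assoc, ← map_mul]
  rw [h.coeff_sum fun J => f * h.coeff a J]

theorem list_prod_mem (h : IsGrassmann G P τ) (l : List (Fin q)) :
    (l.map τ).prod ∈ G (l.length : ZMod 2) := by
  induction l with
  | nil => simpa using h.isSupercommutative.one_mem
  | cons k l ih =>
    have := h.isSupercommutative.mul_mem (h.odd_mem k) ih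
    rw [List.map_cons, List.prod_cons, List.length_cons, Nat.cast_succ, add_comm]
    exact this

theorem oddMonomial_mem (h : IsGrassmann G P τ) (I : Finset (Fin q)) :
    oddMonomial τ I ∈ G (I.card : ZMod 2) := by
  have := h.list_prod_mem I.sort
  rwa [Finset.length_sort] at this

theorem monomial_mem (h : IsGrassmann G P τ) (f : R) (I : Finset (Fin q)) :
    P f * oddMonomial τ I ∈ G (I.card : ZMod 2) := by
  simpa using h.isSupercommutative.mul_mem (h.map_mem f) (h.oddMonomial_mem I)

/-- The given grading agrees with the grading by |I|. The monomials of the wrong parity sum to an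
element of `G (i + 1)` which is also a difference of elements of `G i`, so the sum is zero and
unique expansion kills its coefficients. -/
theorem coeff_eq_zero_of_mem (h : IsGrassmann G P τ) {i : ZMod 2} {a : A} (ha : a ∈ G i)
    {I : Finset (Fin q)} (hI : (I.card : ZMod 2) ≠ i) : h.coeff a I = 0 := by
  let f : Finset (Fin q) → R := fun J => if (J.card : ZMod 2) = i then h.coeff a J else 0
  let g : Finset (Fin q) → R := fun J => if (J.card : ZMod 2) = i then 0 else h.coeff a J
  have hfg : ∑ J, P (f J) * oddMonomial τ J + ∑ J, P (g J) * oddMonomial τ J = a := by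
    rw [← Finset.sum_add_distrib]
    conv_rhs => rw [← h.sum_coeff a]
    refine Finset.sum_congr rfl fun J _ => ?_
    by_cases hJ : (J.card : ZMod 2) = i <;> simp [f, g, hJ]
  have hf : ∑ J, P (f J) * oddMonomial τ J ∈ G i := by
    refine Submodule.sum_mem _ fun J _ => ?_
    by_cases hJ : (J.card : ZMod 2) = i
    · exact hJ ▸ h.monomial_mem _ _
    · simp [f, hJ]
  have hg : ∑ J, P (g J) * oddMonomial τ J ∈ G (i + 1) := by
    refine Submodule.sum_mem _ fun J _ => ?_
    by_cases hJ : (J.card : ZMod 2) = i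
    · simp [g, hJ]
    · have : (J.card : ZMod 2) = i + 1 := by
        revert hJ; generalize (J.card : ZMod 2) = k; clear * -; decide +revert
      exact this ▸ h.monomial_mem _ _
  have hg' : ∑ J, P (g J) * oddMonomial τ J ∈ G i := by
    rw [eq_sub_of_add_eq' hfg]
    exact Submodule.sub_mem _ ha hf
  have hdisj : Disjoint (G i) (G (i + 1)) := by
    have h2 : ∀ k : ZMod 2, k = 0 ∨ k = 1 := by decide
    rcases h2 i with rfl | rfl
    · exact h.isSupercommutative.isCompl.disjoint
    · exact h.isSupercommutative.isCompl.disjoint.symm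
  have := h.coeff_sum g
  rw [Submodule.disjoint_def.1 hdisj _ hg' hg, map_zero] at this
  have := congrFun this I
  simpa [g, hI] using this.symm

/-- Elements of `G i` are sums of monomials of parity `i`. -/
theorem induction_of_mem (h : IsGrassmann G P τ) {i : ZMod 2} {Q : A → Prop} (h0 : Q 0)
    (hadd : ∀ a b, Q a → Q b → Q (a + b))
    (hm : ∀ f I, (I.card : ZMod 2) = i → Q (P f * oddMonomial τ I)) {a : A} (ha : a ∈ G i) :
    Q a := by
  rw [← h.sum_coeff a]
  refine Finset.sum_induction _ Q hadd h0 fun I _ => ?_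
  by_cases hI : (I.card : ZMod 2) = i
  · exact hm _ _ hI
  · simpa [h.coeff_eq_zero_of_mem ha hI] using h0

theorem induction (h : IsGrassmann G P τ) {Q : A → Prop} (h0 : Q 0)
    (hadd : ∀ a b, Q a → Q b → Q (a + b))
    (hm : ∀ f I, Q (P f * oddMonomial τ I)) (a : A) : Q a := by
  rw [← h.sum_coeff a]
  exact Finset.sum_induction _ Q hadd h0 fun I _ => hm _ _

/-- The extension of a linear map of `R` that kills the `τ j`. -/
noncomputable def evenDeriv (h : IsGrassmann G P τ) (δ : R →ₗ[ℝ] R) : A →ₗ[ℝ] A where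
  toFun a := ∑ I, P (δ (h.coeff a I)) * oddMonomial τ I
  map_add' a b := by simp [add_mul, Finset.sum_add_distrib]
  map_smul' r a := by simp [Finset.smul_sum]

/-- The derivative with respect to `τ j`. -/
noncomputable def oddDeriv (h : IsGrassmann G P τ) (j : Fin q) : A →ₗ[ℝ] A where
  toFun a := ∑ I, if j ∈ I then
    (-1 : ℝ) ^ (I.filter (· < j)).card • (P (h.coeff a I) * oddMonomial τ (I.erase j)) else 0
  map_add' a b := by
    rw [← Finset.sum_add_distrib]
    refine Finset.sum_congr rfl fun I _ => ?_
    split_ifs <;> simp [add_mul]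
  map_smul' r a := by
    rw [Finset.smul_sum]
    refine Finset.sum_congr rfl fun I _ => ?_
    split_ifs <;> simp [smul_comm r]

theorem evenDeriv_monomial (h : IsGrassmann G P τ) (δ : R →ₗ[ℝ] R) (f : R)
    (I : Finset (Fin q)) :
    h.evenDeriv δ (P f * oddMonomial τ I) = P (δ f) * oddMonomial τ I := by
  change (∑ J : Finset (Fin q), _) = _
  rw [h.coeff_monomial, Finset.sum_eq_single I (fun J _ hJ => by simp [hJ]) (by simp)]
  simp

theorem oddDeriv_monomial (h : IsGrassmann G P τ) (j : Fin q) (f : R) (I : Finset (Fin q)) :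
    h.oddDeriv j (P f * oddMonomial τ I) = if j ∈ I then
      (-1 : ℝ) ^ (I.filter (· < j)).card • (P f * oddMonomial τ (I.erase j)) else 0 := by
  change (∑ J : Finset (Fin q), _) = _
  rw [h.coeff_monomial, Finset.sum_eq_single I (fun J _ hJ => by simp [hJ]) (by simp)]
  simp

theorem evenDeriv_map_mul_list_prod (h : IsGrassmann G P τ) (δ : R →ₗ[ℝ] R) (f : R)
    (l : List (Fin q)) (J : Finset (Fin q)) :
    h.evenDeriv δ (P f * ((l.map τ).prod * oddMonomial τ J)) =
      P (δ f) * ((l.map τ).prod * oddMonomial τ J) := by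
  obtain ⟨r, K, e⟩ := exists_list_prod_mul_oddMonomial h.anticomm l J
  rw [e, mul_smul_comm, map_smul, evenDeriv_monomial, mul_smul_comm]

theorem evenDeriv_superderivation (h : IsGrassmann G P τ) (δ : R →ₗ[ℝ] R)
    (hδ : ∀ f g, δ (f * g) = δ f * g + f * δ g) : IsSuperderivation G 0 (h.evenDeriv δ) where
  mem {i a} ha := by
    rw [zero_add]
    refine h.induction_of_mem (Q := fun a => h.evenDeriv δ a ∈ G i) (by simp)
      (fun a b ha hb => by rw [map_add]; exact Submodule.add_mem _ ha hb) (fun f I hI => ?_) ha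
    rw [evenDeriv_monomial]
    exact hI ▸ h.monomial_mem _ _
  leibniz {i a} ha b := by
    rw [zero_mul, koszulSign_zero, one_smul]
    clear ha
    induction a using h.induction with
    | h0 => simp
    | hadd a a' ha ha' => rw [add_mul, map_add, ha, ha', map_add, add_mul, add_mul]; abel
    | hm f I =>
    induction b using h.induction with
    | h0 => simp
    | hadd b b' hb hb' => rw [mul_add, map_add, hb, hb', map_add, mul_add, mul_add]; abel
    | hm g J =>
    have e : ∀ f g : R, P f * oddMonomial τ I * (P g * oddMonomial τ J) =
        P (f * g) * (oddMonomial τ I * oddMonomial τ J) := fun f g => by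
      rw [mul_assoc, ← mul_assoc (oddMonomial τ I), ← h.central, map_mul]
      simp only [mul_assoc]
    have e' : ∀ f : R, h.evenDeriv δ (P f * (oddMonomial τ I * oddMonomial τ J)) =
        P (δ f) * (oddMonomial τ I * oddMonomial τ J) := fun f => by
      rw [show oddMonomial τ I = (I.sort.map τ).prod from rfl, evenDeriv_map_mul_list_prod]
    rw [evenDeriv_monomial, evenDeriv_monomial, e f g, e (δ f) g, e f (δ g), e', hδ, map_add,
      add_mul]

theorem evenDeriv_comm (h : IsGrassmann G P τ) (δ δ' : R →ₗ[ℝ] R)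
    (hδ : ∀ f, δ (δ' f) = δ' (δ f)) (a : A) :
    h.evenDeriv δ (h.evenDeriv δ' a) = h.evenDeriv δ' (h.evenDeriv δ a) := by
  induction a using h.induction with
  | h0 => simp
  | hadd a b ha hb => simp only [map_add, ha, hb]
  | hm f I =>
    simp only [evenDeriv_monomial, hδ]

theorem evenDeriv_map (h : IsGrassmann G P τ) (δ : R →ₗ[ℝ] R) (f : R) :
    h.evenDeriv δ (P f) = P (δ f) := by
  simpa [oddMonomial_empty] using h.evenDeriv_monomial δ f ∅

theorem evenDeriv_odd (h : IsGrassmann G P τ) (δ : R →ₗ[ℝ] R) (hδ : δ 1 = 0) (j : Fin q) :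
    h.evenDeriv δ (τ j) = 0 := by
  simpa [oddMonomial_singleton, hδ] using h.evenDeriv_monomial δ 1 {j}

theorem oddDeriv_map (h : IsGrassmann G P τ) (j : Fin q) (f : R) :
    h.oddDeriv j (P f) = 0 := by
  simpa [oddMonomial_empty] using h.oddDeriv_monomial j f ∅

theorem oddDeriv_odd (h : IsGrassmann G P τ) (i j : Fin q) :
    h.oddDeriv i (τ j) = if i = j then 1 else 0 := by
  have := h.oddDeriv_monomial i 1 {j}
  simp only [map_one, one_mul, oddMonomial_singleton, Finset.mem_singleton] at this
  rw [this]
  split_ifs with hij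
  · subst hij
    simp [oddMonomial_empty, Finset.filter_singleton]
  · rfl

theorem evenDeriv_oddDeriv_comm (h : IsGrassmann G P τ) (δ : R →ₗ[ℝ] R) (j : Fin q) (a : A) :
    h.evenDeriv δ (h.oddDeriv j a) = h.oddDeriv j (h.evenDeriv δ a) := by
  induction a using h.induction with
  | h0 => simp
  | hadd a b ha hb => simp only [map_add, ha, hb]
  | hm f I =>
    simp only [evenDeriv_monomial, oddDeriv_monomial]
    split_ifs <;> simp [evenDeriv_monomial]

theorem oddDeriv_map_mul (h : IsGrassmann G P τ) (j : Fin q) (f : R) (a : A) :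
    h.oddDeriv j (P f * a) = P f * h.oddDeriv j a := by
  induction a using h.induction with
  | h0 => simp
  | hadd a b ha hb => simp only [mul_add, map_add, ha, hb]
  | hm g I =>
    rw [← mul_assoc, ← map_mul, oddDeriv_monomial, oddDeriv_monomial]
    split_ifs <;> simp [mul_assoc]

/-- The graded Leibniz rule for one generator, which carries the sign bookkeeping. If j ≠ k are such
that k ∉ I and j ∈ I, exactly one of the two counts changes by one, according to whether j < k or k
< j, and either way the total sign is -1. -/
theorem oddDeriv_mul_oddMonomial (h : IsGrassmann G P τ) (j k : Fin q) (I : Finset (Fin q)) :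
    h.oddDeriv j (τ k * oddMonomial τ I) =
      (if j = k then oddMonomial τ I else 0) - τ k * h.oddDeriv j (oddMonomial τ I) := by
  have e : ∀ I, h.oddDeriv j (oddMonomial τ I) = if j ∈ I then
      (-1 : ℝ) ^ (I.filter (· < j)).card • oddMonomial τ (I.erase j) else 0 := fun I => by
    simpa using h.oddDeriv_monomial j 1 I
  have hk := mul_oddMonomial h.anticomm k
  by_cases hkI : k ∈ I
  · rw [hk, if_pos hkI, map_zero, e]
    by_cases hjk : j = k
    · subst hjk
      have hf : (I.erase j).filter (· < j) = I.filter (· < j) := by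
        ext i; simp only [Finset.mem_filter, Finset.mem_erase]
        exact ⟨fun h => ⟨h.1.2, h.2⟩, fun h => ⟨⟨h.2.ne, h.1⟩, h.2⟩⟩
      rw [if_pos rfl, if_pos hkI, mul_smul_comm, hk, if_neg (by simp), hf, smul_smul, ← pow_add,
        Even.neg_one_pow ⟨_, rfl⟩, one_smul, Finset.insert_erase hkI, sub_self]
    · rw [if_neg hjk]
      split_ifs with hjI
      · rw [mul_smul_comm, hk, if_pos (Finset.mem_erase.2 ⟨Ne.symm hjk, hkI⟩)]; simp
      · simp
  · rw [hk, if_neg hkI, map_smul, e, e]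
    by_cases hjk : j = k
    · subst hjk
      have hf : (insert j I).filter (· < j) = I.filter (· < j) := by
        rw [Finset.filter_insert, if_neg (lt_irrefl _)]
      rw [if_pos rfl, if_pos (Finset.mem_insert_self _ _), if_neg hkI, hf, smul_smul, ← pow_add,
        Even.neg_one_pow ⟨_, rfl⟩, one_smul, Finset.erase_insert hkI]; simp
    · rw [if_neg hjk]
      by_cases hjI : j ∈ I
      · rw [if_pos (Finset.mem_insert_of_mem hjI), if_pos hjI, mul_smul_comm, hk,
          if_neg (fun h => hkI (Finset.mem_of_mem_erase h)),
          Finset.erase_insert_of_ne (Ne.symm hjk), smul_smul, smul_smul, zero_sub, ← neg_smul]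
        congr 1
        rcases lt_or_gt_of_ne hjk with hlt | hlt
        · rw [Finset.filter_insert, if_neg hlt.not_gt, Finset.filter_erase,
            ← Finset.card_erase_add_one (Finset.mem_filter.2 ⟨hjI, hlt⟩), pow_succ]
          ring
        · rw [Finset.filter_insert, if_pos hlt, Finset.card_insert_of_notMem (by simp [hkI]),
            Finset.filter_erase, Finset.erase_eq_of_notMem (by simp [hlt.le]), pow_succ]
          ring
      · rw [if_neg hjI, if_neg (by simp [hjI, hjk])]; simp

theorem oddDeriv_odd_mul (h : IsGrassmann G P τ) (j k : Fin q) (a : A) :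
    h.oddDeriv j (τ k * a) = (if j = k then a else 0) - τ k * h.oddDeriv j a := by
  induction a using h.induction with
  | h0 => simp
  | hadd a b ha hb =>
    rw [mul_add, map_add, ha, hb, map_add, mul_add]
    split_ifs <;> abel
  | hm f I =>
    rw [← mul_assoc, ← h.central, mul_assoc, oddDeriv_map_mul, oddDeriv_map_mul,
      oddDeriv_mul_oddMonomial, ← mul_assoc (τ k), ← h.central, mul_sub, mul_assoc]
    split_ifs <;> simp

/-- Arbitrary words replace increasing monomials so that the Leibniz rule can be proved by removing
the first letter. -/
theorem oddDeriv_list_prod_mul (h : IsGrassmann G P τ) (j : Fin q) (l : List (Fin q)) (a : A) :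
    h.oddDeriv j ((l.map τ).prod * a) = h.oddDeriv j (l.map τ).prod * a +
      koszulSign (l.length : ZMod 2) • ((l.map τ).prod * h.oddDeriv j a) := by
  induction l generalizing a with
  | nil =>
    have : h.oddDeriv j (1 : A) = 0 := by simpa using h.oddDeriv_map j 1
    simp [this, koszulSign_zero]
  | cons k l ih =>
    rw [List.map_cons, List.prod_cons, mul_assoc, oddDeriv_odd_mul, ih, oddDeriv_odd_mul,
      List.length_cons, Nat.cast_succ, koszulSign_add_one, mul_add, sub_mul, mul_smul_comm,
      neg_smul]
    split_ifs <;> simp only [mul_assoc, zero_mul] <;> abel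

theorem oddDeriv_superderivation (h : IsGrassmann G P τ) (j : Fin q) :
    IsSuperderivation G 1 (h.oddDeriv j) where
  mem {i a} ha := by
    refine h.induction_of_mem (Q := fun a => h.oddDeriv j a ∈ G (1 + i)) (by simp)
      (fun a b ha hb => by rw [map_add]; exact Submodule.add_mem _ ha hb) (fun f I hI => ?_) ha
    rw [oddDeriv_monomial]
    split_ifs with hj
    · refine Submodule.smul_mem _ _ ?_
      have : ((I.erase j).card : ZMod 2) = 1 + i := by
        rw [← hI, ← Finset.card_erase_add_one hj, Nat.cast_succ]
        generalize ((I.erase j).card : ZMod 2) = k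
        clear * -; decide +revert
      exact this ▸ h.monomial_mem _ _
    · exact Submodule.zero_mem _
  leibniz {i a} ha b := by
    refine h.induction_of_mem (Q := fun a => h.oddDeriv j (a * b) = h.oddDeriv j a * b +
      koszulSign (1 * i) • (a * h.oddDeriv j b)) (by simp) (fun a a' ha ha' => ?_)
      (fun f I hI => ?_) ha
    · rw [add_mul, map_add, ha, ha', map_add, add_mul, add_mul, smul_add]; abel
    · have := h.oddDeriv_list_prod_mul j I.sort b
      rw [Finset.length_sort, hI] at this
      change h.oddDeriv j (oddMonomial τ I * b) = h.oddDeriv j (oddMonomial τ I) * b +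
        koszulSign i • (oddMonomial τ I * h.oddDeriv j b) at this
      rw [mul_assoc, oddDeriv_map_mul, this, oddDeriv_map_mul, mul_add, one_mul, mul_smul_comm]
      simp only [mul_assoc]

theorem oddDeriv_anticomm (h : IsGrassmann G P τ) (i j : Fin q) (a : A) :
    h.oddDeriv i (h.oddDeriv j a) = -h.oddDeriv j (h.oddDeriv i a) := by
  have key : ∀ l : List (Fin q), h.oddDeriv i (h.oddDeriv j (l.map τ).prod) =
      -h.oddDeriv j (h.oddDeriv i (l.map τ).prod) := by
    intro l
    induction l with
    | nil =>
      have : ∀ j, h.oddDeriv j (1 : A) = 0 := fun j => by simpa using h.oddDeriv_map j 1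
      simp [this]
    | cons k l ih =>
      simp only [List.map_cons, List.prod_cons, oddDeriv_odd_mul, map_sub, apply_ite
        (h.oddDeriv i), apply_ite (h.oddDeriv j), map_zero, ih, mul_neg]
      split_ifs <;> abel
  induction a using h.induction with
  | h0 => simp
  | hadd a b ha hb => simp only [map_add, ha, hb, neg_add]
  | hm f I =>
    simp only [oddDeriv_map_mul]
    rw [oddMonomial, key, mul_neg]

end IsGrassmann

end Grassmann

/-! ### Partial derivatives of smooth functions -/

namespace smoothFunctions

variable {p : ℕ} {Ω : Opens (Fin p → ℝ)}

theorem ext_apply {f g : smoothFunctions Ω} (h : ∀ x, f.1 x = g.1 x) : f = g :=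
  Subtype.ext (funext h)

theorem contDiffAt_extend (f : smoothFunctions Ω) (x : Ω) :
    ContDiffAt ℝ ∞ (Function.extend Subtype.val f.1 0) x.1 :=
  ContDiffOn.contDiffAt f.2 (Ω.isOpen.mem_nhds x.2)

theorem differentiableAt_extend (f : smoothFunctions Ω) (x : Ω) :
    DifferentiableAt ℝ (Function.extend Subtype.val f.1 0) x.1 :=
  (contDiffAt_extend f x).differentiableAt (by simp)

theorem extend_eventuallyEq {f : Ω → ℝ} {F : (Fin p → ℝ) → ℝ} {x : Fin p → ℝ}
    {U : Set (Fin p → ℝ)} (hU : IsOpen U) (hx : x ∈ U) (hx' : x ∈ Ω)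
    (h : ∀ y : Ω, y.1 ∈ U → f y = F y) :
    Function.extend Subtype.val f 0 =ᶠ[nhds x] F := by
  filter_upwards [Ω.isOpen.mem_nhds hx', hU.mem_nhds hx] with y hy hy'
  rw [extend_val_of_mem _ hy, h ⟨y, hy⟩ hy']

/-- A derivative at a point of the open set Ω sees only the germ there, so any ambient F may replace
the extension by zero, which can be discontinuous at the boundary. -/
theorem partialDeriv_apply (i : Fin p) (f : smoothFunctions Ω) (x : Ω) {F : (Fin p → ℝ) → ℝ}
    {U : Set (Fin p → ℝ)} (hU : IsOpen U) (hx : x.1 ∈ U) (h : ∀ y : Ω, y.1 ∈ U → f.1 y = F y) :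
    (partialDeriv i f).1 x = fderiv ℝ F x.1 (Pi.single i 1) := by
  change fderiv ℝ (Function.extend Subtype.val f.1 0) x.1 (Pi.single i 1) = _
  rw [(extend_eventuallyEq hU hx x.2 h).fderiv_eq]

theorem apply_eq_extend (f : smoothFunctions Ω) (y : Ω) :
    f.1 y = Function.extend Subtype.val f.1 0 y.1 := (extend_val_of_mem f.1 y.2).symm

/-- `∂/∂x^i` as a linear map. -/
noncomputable def partialDerivₗ (i : Fin p) : smoothFunctions Ω →ₗ[ℝ] smoothFunctions Ω where
  toFun := partialDeriv i
  map_add' f g := ext_apply fun x => by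
    rw [partialDeriv_apply i (f + g) x isOpen_univ (Set.mem_univ _)
      (F := Function.extend Subtype.val f.1 0 + Function.extend Subtype.val g.1 0)
      (fun y _ => by
        rw [Pi.add_apply, ← apply_eq_extend, ← apply_eq_extend]; rfl),
      fderiv_add (differentiableAt_extend f x) (differentiableAt_extend g x)]
    rfl
  map_smul' r f := ext_apply fun x => by
    rw [partialDeriv_apply i (r • f) x isOpen_univ (Set.mem_univ _)
      (F := r • Function.extend Subtype.val f.1 0)
      (fun y _ => by
        rw [Pi.smul_apply, ← apply_eq_extend]; rfl),
      fderiv_const_smul (differentiableAt_extend f x)]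
    rfl

theorem partialDeriv_mul (i : Fin p) (f g : smoothFunctions Ω) :
    partialDeriv i (f * g) = partialDeriv i f * g + f * partialDeriv i g :=
  ext_apply fun x => by
    rw [partialDeriv_apply i (f * g) x isOpen_univ (Set.mem_univ _)
      (F := Function.extend Subtype.val f.1 0 * Function.extend Subtype.val g.1 0)
      (fun y _ => by
        rw [Pi.mul_apply, ← apply_eq_extend, ← apply_eq_extend]; rfl),
      fderiv_mul (differentiableAt_extend f x) (differentiableAt_extend g x)]
    change _ = fderiv ℝ _ _ _ * g.1 x + f.1 x * fderiv ℝ _ _ _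
    rw [apply_eq_extend f, apply_eq_extend g]
    simp only [add_apply, smul_apply, smul_eq_mul]
    ring

theorem partialDeriv_comm (i j : Fin p) (f : smoothFunctions Ω) :
    partialDeriv i (partialDeriv j f) = partialDeriv j (partialDeriv i f) :=
  ext_apply fun x => by
    have key : ∀ i j, (partialDeriv i (partialDeriv j f)).1 x =
        fderiv ℝ (fderiv ℝ (Function.extend Subtype.val f.1 0)) x.1 (Pi.single i 1)
          (Pi.single j 1) := by
      intro i j
      have hd : DifferentiableAt ℝ (fderiv ℝ (Function.extend Subtype.val f.1 0)) x.1 :=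
        ((contDiffAt_extend f x).fderiv_right (m := 1) (by norm_cast)).differentiableAt (by simp)
      rw [partialDeriv_apply i (partialDeriv j f) x isOpen_univ (Set.mem_univ _)
        (F := fun y => fderiv ℝ (Function.extend Subtype.val f.1 0) y (Pi.single j 1))
        (fun y _ => rfl), fderiv_clm_apply hd (differentiableAt_const _)]
      simp
    rw [key, key]
    exact ((contDiffAt_extend f x).isSymmSndFDerivAt (by simp; norm_cast)) _ _

theorem partialDeriv_coordinate (i k : Fin p) :
    partialDeriv i (coordinate Ω k) = if i = k then 1 else 0 :=
  ext_apply fun x => by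
    rw [partialDeriv_apply i (coordinate Ω k) x isOpen_univ (Set.mem_univ _)
      (F := fun y => ContinuousLinearMap.proj (R := ℝ) (φ := fun _ : Fin p => ℝ) k y)
      (fun y _ => rfl), ContinuousLinearMap.fderiv]
    split_ifs with h
    · subst h; simp
    · simp [Ne.symm h]

theorem partialDeriv_restrict {Ω' : Opens (Fin p → ℝ)} (h : Ω' ≤ Ω) (i : Fin p)
    (f : smoothFunctions Ω) :
    partialDeriv i (restrict h f) = restrict h (partialDeriv i f) :=
  ext_apply fun x => by
    rw [partialDeriv_apply i (restrict h f) x isOpen_univ (Set.mem_univ _)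
      (F := Function.extend Subtype.val f.1 0) (fun y _ => by
        exact apply_eq_extend f ⟨y.1, h y.2⟩)]
    rfl

end smoothFunctions

/-! ### Coordinates and partial derivatives of a chart -/

namespace SuperSpace

variable {X : SuperSpace.{u}}

theorem res_res {U V W : Opens X.carrier} (h : V ≤ U) (h' : W ≤ V) (f : X.sec U) :
    X.res h' (X.res h f) = X.res (h'.trans h) f := by
  have := X.sheaf.presheaf.map_comp (homOfLE h).op (homOfLE h').op
  exact (congrArg (fun t => t.hom f) this).symm

theorem res_self {U : Opens X.carrier} (h : U ≤ U) (f : X.sec U) : X.res h f = f := by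
  have := X.sheaf.presheaf.map_id (op U)
  exact congrArg (fun t => t.hom f) this

namespace Chart

variable {p q : ℕ} (c : X.Chart p q) {W W' : Opens X.carrier}

theorem isGrassmann (h : W ≤ c.dom) :
    IsGrassmann (X.gr W) (c.pull W h) (fun j => X.res h (c.θ j)) where
  isSupercommutative := X.isSupercommutative W
  map_mem := c.pull_even W h
  odd_mem j := X.res_mem_gr _ _ h _ _ (c.θ_odd j)
  bijective := c.expansion_bijective W h

theorem coeff_eq (h : W ≤ c.dom) (f : X.sec W) : c.coeff h f = (c.isGrassmann h).coeff f :=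
  (Equiv.symm_apply_eq _).2 ((c.isGrassmann h).sum_coeff f).symm

/-- `∂/∂x^a` as a linear map. -/
noncomputable def pderivₗ (a : Fin p ⊕ Fin q) (h : W ≤ c.dom) : X.sec W →ₗ[ℝ] X.sec W :=
  match a with
  | Sum.inl i => (c.isGrassmann h).evenDeriv (smoothFunctions.partialDerivₗ i)
  | Sum.inr j => (c.isGrassmann h).oddDeriv j

theorem pderivₗ_apply (a : Fin p ⊕ Fin q) (h : W ≤ c.dom) (f : X.sec W) :
    c.pderivₗ a h f = c.pderiv a h f := by
  rcases a with i | j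
  · simp only [pderiv, c.coeff_eq]
    rfl
  · simp only [pderiv, c.coeff_eq]
    rfl

theorem coord_mem (a : Fin p ⊕ Fin q) : c.coord a ∈ X.gr c.dom (coordParity a) := by
  rcases a with i | j
  · exact c.pull_even _ _ _
  · exact c.θ_odd j

theorem res_coord_inl (h : W ≤ c.dom) (i : Fin p) :
    X.res h (c.coord (Sum.inl i)) = c.pull W h (smoothFunctions.coordinate _ i) := by
  change X.res h (c.pull _ _ _) = _
  rw [c.res_pull]
  rfl

theorem isCoordinateFrame (h : W ≤ c.dom) : IsCoordinateFrame (X.gr W) coordParity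
    (fun a => X.res h (c.coord a)) (fun a => c.pderivₗ a h) where
  x_mem a := X.res_mem_gr _ _ h _ _ (c.coord_mem a)
  superderivation a := by
    rcases a with i | j
    · exact (c.isGrassmann h).evenDeriv_superderivation _ (smoothFunctions.partialDeriv_mul i)
    · exact (c.isGrassmann h).oddDeriv_superderivation j
  d_comm a b f := by
    rcases a with i | i <;> rcases b with j | j <;>
      simp only [coordParity, Sum.elim_inl, Sum.elim_inr, mul_zero, koszulSign_zero,
        one_smul, mul_one, koszulSign_one, neg_one_smul]
    · exact (c.isGrassmann h).evenDeriv_comm _ _ (smoothFunctions.partialDeriv_comm i j) f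
    · exact (c.isGrassmann h).evenDeriv_oddDeriv_comm _ j f
    · exact ((c.isGrassmann h).evenDeriv_oddDeriv_comm _ i f).symm
    · exact (c.isGrassmann h).oddDeriv_anticomm i j f

theorem pderivₗ_coord (h : W ≤ c.dom) (a b : Fin p ⊕ Fin q) :
    c.pderivₗ a h (X.res h (c.coord b)) = if a = b then 1 else 0 := by
  rcases b with k | k
  · rw [res_coord_inl]
    rcases a with i | i
    · change (c.isGrassmann h).evenDeriv _ _ = _
      rw [IsGrassmann.evenDeriv_map]
      change c.pull W h (smoothFunctions.partialDeriv i _) = _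
      rw [smoothFunctions.partialDeriv_coordinate]
      by_cases hik : i = k
      · rw [if_pos hik, if_pos (congrArg Sum.inl hik), map_one]
      · rw [if_neg hik, if_neg (fun h => hik (Sum.inl.inj h)), map_zero]
    · change (c.isGrassmann h).oddDeriv _ _ = _
      rw [IsGrassmann.oddDeriv_map]
      simp
  · rcases a with i | i
    · have h1 : smoothFunctions.partialDerivₗ i (1 : smoothFunctions (openImage c.φ W)) = 0 := by
        have := smoothFunctions.partialDeriv_mul i (1 : smoothFunctions (openImage c.φ W)) 1
        rw [mul_one, mul_one, one_mul] at this
        exact add_left_cancel (this.symm.trans (add_zero _).symm)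
      exact ((c.isGrassmann h).evenDeriv_odd _ h1 k).trans (by simp)
    · exact ((c.isGrassmann h).oddDeriv_odd i k).trans (by simp)

theorem res_oddMonomial (h : W ≤ c.dom) (h' : W' ≤ W) (I : Finset (Fin q)) :
    X.res h' (oddMonomial (fun j => X.res h (c.θ j)) I) =
      oddMonomial (fun j => X.res (h'.trans h) (c.θ j)) I := by
  simp only [oddMonomial, map_list_prod, List.map_map]
  congr 2
  funext j
  exact res_res h h' _

theorem res_pderivₗ (h : W ≤ c.dom) (h' : W' ≤ W) (a : Fin p ⊕ Fin q) (f : X.sec W) :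
    X.res h' (c.pderivₗ a h f) = c.pderivₗ a (h'.trans h) (X.res h' f) := by
  induction f using (c.isGrassmann h).induction with
  | h0 => simp
  | hadd f g hf hg => simp only [map_add, hf, hg]
  | hm f I =>
    rw [map_mul (X.res h'), c.res_pull, res_oddMonomial]
    rcases a with i | j
    · change X.res h' ((c.isGrassmann h).evenDeriv _ _) = (c.isGrassmann (h'.trans h)).evenDeriv _ _
      rw [IsGrassmann.evenDeriv_monomial, IsGrassmann.evenDeriv_monomial, map_mul, c.res_pull,
        res_oddMonomial]
      congr 2
      exact (smoothFunctions.partialDeriv_restrict _ i f).symm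
    · change X.res h' ((c.isGrassmann h).oddDeriv _ _) = (c.isGrassmann (h'.trans h)).oddDeriv _ _
      rw [IsGrassmann.oddDeriv_monomial, IsGrassmann.oddDeriv_monomial]
      split_ifs
      · rw [map_smul, map_mul, c.res_pull, res_oddMonomial]
      · simp

theorem coeff_res (h : W ≤ c.dom) (h' : W' ≤ W) (f : X.sec W) (I : Finset (Fin q)) :
    (c.isGrassmann (h'.trans h)).coeff (X.res h' f) I =
      smoothFunctions.restrict (openImage_mono c.φ h') ((c.isGrassmann h).coeff f I) := by
  conv_lhs => rw [← (c.isGrassmann h).sum_coeff f]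
  rw [map_sum (X.res h')]
  simp only [map_mul, c.res_pull, res_oddMonomial]
  rw [(c.isGrassmann (h'.trans h)).coeff_sum
    (fun I => smoothFunctions.restrict (openImage_mono c.φ h') ((c.isGrassmann h).coeff f I))]

end Chart

end SuperSpace

/-! ### Hadamard's lemma -/

section Hadamard

/-- Differentiation under the integral sign, by induction on n. The induction runs over all F at
once because the derivative takes values in `E →L[ℝ] F`. -/
theorem contDiff_intervalIntegral_of_contDiff {E : Type} [NormedAddCommGroup E] [NormedSpace ℝ E]
    [FiniteDimensional ℝ E] (n : ℕ) : ∀ {F : Type} [NormedAddCommGroup F] [NormedSpace ℝ F]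
    [CompleteSpace F] {f : E × ℝ → F}, ContDiff ℝ ∞ f →
    ContDiff ℝ n (fun x => ∫ t in (0 : ℝ)..1, f (x, t)) := by
  have hc : ∀ {F : Type} [NormedAddCommGroup F] [NormedSpace ℝ F] {f : E × ℝ → F},
      Continuous f → Continuous (fun x => ∫ t in (0 : ℝ)..1, f (x, t)) := by
    intro F _ _ f hf
    exact intervalIntegral.continuous_parametric_intervalIntegral_of_continuous'
      (f := fun x t => f (x, t)) hf 0 1
  induction n with
  | zero =>
    intro F _ _ _ f hf
    exact contDiff_zero.2 (hc hf.continuous)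
  | succ n ih =>
    intro F _ _ _ f hf
    let f' : E × ℝ → E →L[ℝ] F := fun z =>
      (fderiv ℝ f z).comp (ContinuousLinearMap.inl ℝ E ℝ)
    have hf' : ContDiff ℝ ∞ f' :=
      (hf.fderiv_right (m := ∞) (by simp)).clm_comp contDiff_const
    have hd : ∀ x t, HasFDerivAt (fun x => f (x, t)) (f' (x, t)) x := by
      intro x t
      have h1 : HasFDerivAt f (fderiv ℝ f (x, t)) (x, t) :=
        (hf.differentiable (by simp) _).hasFDerivAt
      exact h1.comp x (hasFDerivAt_prodMk_left x t)
    rw [show ((n + 1 : ℕ) : WithTop ℕ∞) = (n : WithTop ℕ∞) + 1 by norm_cast,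
      contDiff_succ_iff_hasFDerivAt]
    refine ⟨fun x => ∫ t in (0 : ℝ)..1, f' (x, t), ih hf', fun x => ?_⟩
    -- The dominating constant is the maximum bound of the derivative on the compact set (closed
    -- unit ball about x) × [0,1].
    obtain ⟨C, hC⟩ := ((isCompact_closedBall x 1).prod (isCompact_Icc (a := (0 : ℝ)) (b := 1))).exists_bound_of_continuousOn
      hf'.continuous.continuousOn
    refine intervalIntegral.hasFDerivAt_integral_of_dominated_of_fderiv_le
      (F := fun x t => f (x, t)) (F' := fun x t => f' (x, t)) (bound := fun _ => C)
      (Metric.closedBall_mem_nhds x one_pos) ?_ ?_ ?_ ?_ ?_ ?_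
    · exact Filter.Eventually.of_forall fun y =>
        (hf.continuous.comp (by fun_prop : Continuous fun t : ℝ => (y, t))).aestronglyMeasurable
    · exact (hf.continuous.comp (by fun_prop : Continuous fun t : ℝ => (x, t))).intervalIntegrable _ _
    · exact (hf'.continuous.comp (by fun_prop : Continuous fun t : ℝ => (x, t))).aestronglyMeasurable
    · refine Filter.Eventually.of_forall fun t ht y hy => hC (y, t) ⟨hy, ?_⟩
      rw [Set.uIoc_of_le zero_le_one] at ht
      exact ⟨ht.1.le, ht.2⟩
    · exact intervalIntegrable_const
    · exact Filter.Eventually.of_forall fun t _ y _ => hd y t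

/-- Hadamard's lemma. -/
theorem exists_contDiff_eq_add_sum {p : ℕ} {f : (Fin p → ℝ) → ℝ} (hf : ContDiff ℝ ∞ f)
    (y : Fin p → ℝ) : ∃ g : Fin p → (Fin p → ℝ) → ℝ, (∀ i, ContDiff ℝ ∞ (g i)) ∧
      ∀ x, f x = f y + ∑ i, (x i - y i) * g i x := by
  refine ⟨fun i x => ∫ t in (0 : ℝ)..1, fderiv ℝ f (y + t • (x - y)) (Pi.single i 1),
    fun i => ?_, fun x => ?_⟩
  · rw [contDiff_infty]
    intro n
    refine contDiff_intervalIntegral_of_contDiff (E := Fin p → ℝ) n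
      (f := fun z => fderiv ℝ f (y + z.2 • (z.1 - y)) (Pi.single i 1)) ?_
    refine ContDiff.clm_apply ?_ contDiff_const
    exact (hf.fderiv_right (m := ∞) (by simp)).comp (by fun_prop)
  · have hd : ∀ t : ℝ, HasDerivAt (fun t : ℝ => f (y + t • (x - y)))
        (fderiv ℝ f (y + t • (x - y)) (x - y)) t := by
      intro t
      have h1 : HasFDerivAt f _ (y + t • (x - y)) := (hf.differentiable (by simp) _).hasFDerivAt
      have h2 : HasDerivAt (fun t : ℝ => y + t • (x - y)) (x - y) t := by
        simpa using ((hasDerivAt_id t).smul_const (x - y)).const_add y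
      exact h1.comp_hasDerivAt t h2
    have hcont : ∀ v, Continuous fun t : ℝ => fderiv ℝ f (y + t • (x - y)) v := fun v =>
      ((hf.continuous_fderiv (by simp)).comp (by fun_prop)).clm_apply continuous_const
    have := intervalIntegral.integral_eq_sub_of_hasDerivAt (a := 0) (b := 1)
      (fun t _ => hd t) ((hcont _).intervalIntegrable _ _)
    simp only [one_smul, zero_smul, add_zero, add_sub_cancel] at this
    rw [← sub_eq_iff_eq_add', ← this]
    simp only [← intervalIntegral.integral_const_mul]
    rw [← intervalIntegral.integral_finsetSum]
    · congr 1
      funext t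
      generalize fderiv ℝ f (y + t • (x - y)) = L
      conv_lhs => rw [pi_eq_sum_univ' (x - y)]
      simp [map_sum]
    · exact fun i _ => ((hcont _).const_mul _).intervalIntegrable _ _

end Hadamard

/-! ### Superderivations and their generators -/

section

variable {A : Type*} [Ring A] [Algebra ℝ A] {G : ZMod 2 → Submodule ℝ A}

theorem IsSuperderivation.mulLeft_comp (hG : IsSupercommutative G) {γ ε : ZMod 2} {g : A}
    (hg : g ∈ G γ) {D : A →ₗ[ℝ] A} (hD : IsSuperderivation G ε D) :
    IsSuperderivation G (γ + ε) (LinearMap.mulLeft ℝ g ∘ₗ D) where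
  mem {i f} hf := by
    rw [add_assoc]
    exact hG.mul_mem hg (hD.mem hf)
  leibniz {i f} hf k := by
    simp only [LinearMap.comp_apply, LinearMap.mulLeft_apply]
    rw [hD.leibniz hf, mul_add, mul_smul_comm, ← mul_assoc g f, hG.mul_comm hg hf, smul_mul_assoc,
      koszulSign_smul_smul, mul_assoc, mul_assoc, add_mul γ ε i, add_comm (γ * i)]

theorem IsSuperderivation.sub_sum {ι : Type*} (s : Finset ι) {ε : ZMod 2} {D : A →ₗ[ℝ] A}
    {E : ι → A →ₗ[ℝ] A} (hD : IsSuperderivation G ε D) (hE : ∀ a, IsSuperderivation G ε (E a)) :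
    IsSuperderivation G ε (D - ∑ a ∈ s, E a) where
  mem {i f} hf := by
    rw [LinearMap.sub_apply, LinearMap.sum_apply]
    exact Submodule.sub_mem _ (hD.mem hf) (Submodule.sum_mem _ fun a _ => (hE a).mem hf)
  leibniz {i f} hf k := by
    simp only [LinearMap.sub_apply, LinearMap.sum_apply, hD.leibniz hf, (hE _).leibniz hf,
      Finset.sum_add_distrib, sub_mul, mul_sub, smul_sub, Finset.sum_mul, Finset.mul_sum,
      Finset.smul_sum]
    abel

/-- A superderivation that kills the coefficients and the generators vanishes. -/
theorem IsGrassmann.superderivation_eq_zero {q : ℕ} {R : Type*} [CommRing R] [Algebra ℝ R]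
    {P : R →ₐ[ℝ] A} {τ : Fin q → A} (h : IsGrassmann G P τ) {ε : ZMod 2} {D : A →ₗ[ℝ] A}
    (hD : IsSuperderivation G ε D) (hP : ∀ f, D (P f) = 0) (hτ : ∀ j, D (τ j) = 0) (a : A) :
    D a = 0 := by
  have hl : ∀ l : List (Fin q), D (l.map τ).prod = 0 := by
    intro l
    induction l with
    | nil => simpa using hP 1
    | cons k l ih => rw [List.map_cons, List.prod_cons, hD.leibniz (h.odd_mem k), hτ, ih]; simp
  induction a using h.induction with
  | h0 => simp
  | hadd a b ha hb => rw [map_add, ha, hb, add_zero]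
  | hm f I =>
    rw [hD.leibniz_even (h.map_mem f), hP, oddMonomial, hl]
    simp

end

namespace smoothFunctions

variable {p : ℕ} {Ω : Opens (Fin p → ℝ)}

/-- The restriction of a smooth function on `ℝ^p`. -/
def ofContDiff (Ω : Opens (Fin p → ℝ)) (g : (Fin p → ℝ) → ℝ) (hg : ContDiff ℝ ∞ g) :
    smoothFunctions Ω :=
  ⟨fun x => g x.1, hg.contDiffOn.congr fun x hx => by rw [extend_val_of_mem _ hx]⟩

theorem contDiff_mul_extend (f : smoothFunctions Ω) {χ : (Fin p → ℝ) → ℝ} (hχ : ContDiff ℝ ∞ χ)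
    (hs : tsupport χ ⊆ Ω) : ContDiff ℝ ∞ (fun x => χ x * Function.extend Subtype.val f.1 0 x) := by
  rw [contDiff_iff_contDiffAt]
  intro x
  by_cases hx : x ∈ Ω
  · exact hχ.contDiffAt.mul (contDiffAt_extend f ⟨x, hx⟩)
  · have h0 : χ =ᶠ[nhds x] 0 := notMem_tsupport_iff_eventuallyEq.1 fun h => hx (hs h)
    refine (contDiffAt_const (c := (0 : ℝ))).congr_of_eventuallyEq ?_
    filter_upwards [h0] with z hz
    simp [hz]

/-- Near `y`, a smooth function `f` is of the form `f(y) + ∑ (x^i - y^i) g_i(x)`. -/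
theorem exists_hadamard (f : smoothFunctions Ω) (y : Ω) :
    ∃ (U : Opens (Fin p → ℝ)) (g : Fin p → (Fin p → ℝ) → ℝ) (hg : ∀ i, ContDiff ℝ ∞ (g i)),
      y.1 ∈ U ∧ ∀ (Ω' : Opens (Fin p → ℝ)) (h : Ω' ≤ Ω), Ω' ≤ U → restrict h f =
        algebraMap ℝ _ (f.1 y) + ∑ i, (coordinate Ω' i - algebraMap ℝ _ (y.1 i)) *
          ofContDiff Ω' (g i) (hg i) := by
  obtain ⟨r, hr, hrΩ⟩ := Metric.isOpen_iff.1 Ω.isOpen y.1 y.2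
  -- A cutoff equal to 1 on the ball of radius r/4 and supported inside Ω makes f global, as
  -- Hadamard's lemma requires; the resulting formula is valid for f itself on the small ball.
  let χ : ContDiffBump y.1 := ⟨r / 4, r / 2, by positivity, by linarith⟩
  have hs : tsupport χ ⊆ Ω := by
    rw [χ.tsupport_eq]
    exact (Metric.closedBall_subset_ball (by change r / 2 < r; linarith)).trans hrΩ
  obtain ⟨g, hg, hfg⟩ := exists_contDiff_eq_add_sum (contDiff_mul_extend f χ.contDiff hs) y.1
  have h1 : ∀ x (hx : x ∈ Ω), x ∈ Metric.ball y.1 (r / 4) →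
      χ x * Function.extend Subtype.val f.1 0 x = f.1 ⟨x, hx⟩ := fun x hx hxy => by
    rw [χ.one_of_mem_closedBall (Metric.ball_subset_closedBall hxy), one_mul,
      extend_val_of_mem _ hx]
  refine ⟨⟨Metric.ball y.1 (r / 4), Metric.isOpen_ball⟩, g, hg,
    Metric.mem_ball_self (by positivity), fun Ω' h hU => ext_apply fun x => ?_⟩
  have := hfg x.1
  rw [h1 x.1 (h x.2) (hU x.2), h1 y.1 y.2 (Metric.mem_ball_self (by positivity))] at this
  refine this.trans ?_
  have hsum : (∑ i, (coordinate Ω' i - algebraMap ℝ (smoothFunctions Ω') (y.1 i)) *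
      ofContDiff Ω' (g i) (hg i)).1 x = ∑ i, (x.1 i - y.1 i) * g i x.1 := by
    rw [AddSubmonoidClass.coe_finsetSum, Finset.sum_apply]
    rfl
  rw [← hsum]
  rfl

end smoothFunctions

namespace SuperSpace

variable {X : SuperSpace.{u}} {p q : ℕ}

/-- The preimage in a chart of an open subset of `ℝ^p`. -/
def Chart.preimage (c : X.Chart p q) (U : Opens (Fin p → ℝ)) : Opens X.carrier :=
  ⟨c.φ.source ∩ c.φ ⁻¹' U, c.φ.isOpen_inter_preimage U.isOpen⟩

theorem Chart.openImage_inf_preimage (c : X.Chart p q) (W : Opens X.carrier)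
    (U : Opens (Fin p → ℝ)) : openImage c.φ (W ⊓ c.preimage U) = openImage c.φ W ⊓ U := by
  ext x
  constructor
  · rintro ⟨h1, h2, h3, h4⟩
    refine ⟨⟨h1, h2⟩, ?_⟩
    have : c.φ (c.φ.symm x) ∈ U := h4
    rwa [c.φ.right_inv h1] at this
  · rintro ⟨⟨h1, h2⟩, h3⟩
    refine ⟨h1, h2, c.φ.map_target h1, ?_⟩
    change c.φ (c.φ.symm x) ∈ U
    rwa [c.φ.right_inv h1]

end SuperSpace

/-! ### Vector fields are determined by their components -/

namespace SuperVectorField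

variable {X : SuperSpace.{u}} {p q : ℕ} {V : Opens X.carrier} {ε : ZMod 2}

theorem isSuperderivation (Y : SuperVectorField X V ε) {W : Opens X.carrier} (h : W ≤ V) :
    IsSuperderivation (X.gr W) ε (Y.toFun W h) where
  mem hf := Y.mem_gr W h _ _ hf
  leibniz hf g := Y.leibniz W h _ _ hf g

/-- The difference of `Y` and of the vector field with the same components. -/
noncomputable def remainder (Y : SuperVectorField X V ε) (c : X.Chart p q) {W : Opens X.carrier}
    (hV : W ≤ V) (h : W ≤ c.dom) : X.sec W →ₗ[ℝ] X.sec W :=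
  Y.toFun W hV - ∑ a, LinearMap.mulLeft ℝ (Y.toFun W hV (X.res h (c.coord a))) ∘ₗ c.pderivₗ a h

theorem remainder_apply (Y : SuperVectorField X V ε) (c : X.Chart p q) {W : Opens X.carrier}
    (hV : W ≤ V) (h : W ≤ c.dom) (f : X.sec W) : Y.remainder c hV h f =
      Y.toFun W hV f - ∑ a, Y.toFun W hV (X.res h (c.coord a)) * c.pderivₗ a h f := by
  simp [remainder]

theorem remainder_isSuperderivation (Y : SuperVectorField X V ε) (c : X.Chart p q)
    {W : Opens X.carrier} (hV : W ≤ V) (h : W ≤ c.dom) :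
    IsSuperderivation (X.gr W) ε (Y.remainder c hV h) := by
  refine (Y.isSuperderivation hV).sub_sum _ fun a => ?_
  have := IsSuperderivation.mulLeft_comp (X.isSupercommutative W)
    ((Y.isSuperderivation hV).mem ((c.isCoordinateFrame h).x_mem a))
    ((c.isCoordinateFrame h).superderivation a)
  rwa [add_assoc, CharTwo.add_self_eq_zero, add_zero] at this

theorem remainder_coord (Y : SuperVectorField X V ε) (c : X.Chart p q)
    {W : Opens X.carrier} (hV : W ≤ V) (h : W ≤ c.dom) (b : Fin p ⊕ Fin q) :
    Y.remainder c hV h (X.res h (c.coord b)) = 0 := by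
  rw [remainder_apply]
  simp only [c.pderivₗ_coord, mul_ite, mul_one, mul_zero]
  simp

theorem res_remainder (Y : SuperVectorField X V ε) (c : X.Chart p q)
    {W W' : Opens X.carrier} (hV : W ≤ V) (h : W ≤ c.dom) (h' : W' ≤ W) (f : X.sec W) :
    X.res h' (Y.remainder c hV h f) =
      Y.remainder c (h'.trans hV) (h'.trans h) (X.res h' f) := by
  simp only [remainder_apply, map_sub, Y.res_apply]
  rw [map_sum (X.res h')]
  simp only [map_mul, Y.res_apply, c.res_pderivₗ, SuperSpace.res_res]

/-- The coefficients are shown to vanish at each point y. Near y, f = f(y) + Σ (x^i - y^i) g_i. The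
remainder is a superderivation that kills constants and coordinates, so it yields Σ (x^i - y^i)
R(g_i), all of whose coefficients vanish at y. No continuity of the vector field is assumed. -/
theorem remainder_pull (Y : SuperVectorField X V ε) (c : X.Chart p q)
    {W : Opens X.carrier} (hV : W ≤ V) (h : W ≤ c.dom) (f : smoothFunctions (openImage c.φ W)) :
    Y.remainder c hV h (c.pull W h f) = 0 := by
  have hg := c.isGrassmann h
  refine hg.coeff.map_eq_zero_iff.1 (funext fun I => smoothFunctions.ext_apply fun y => ?_)
  obtain ⟨U, g, hgs, hyU, hf⟩ := smoothFunctions.exists_hadamard f y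
  have h' : W ⊓ c.preimage U ≤ W := inf_le_left
  have hy : y.1 ∈ openImage c.φ (W ⊓ c.preimage U) := by
    rw [c.openImage_inf_preimage]; exact ⟨y.2, hyU⟩
  have e1 := c.coeff_res h h' (Y.remainder c hV h (c.pull W h f)) I
  have e2 : (hg.coeff (Y.remainder c hV h (c.pull W h f)) I).1 y =
      (smoothFunctions.restrict (openImage_mono c.φ h')
        (hg.coeff (Y.remainder c hV h (c.pull W h f)) I)).1 ⟨y.1, hy⟩ := rfl
  rw [e2, ← e1, res_remainder, c.res_pull,
    hf _ (openImage_mono c.φ h') (by rw [c.openImage_inf_preimage]; exact inf_le_right)]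
  have hD := Y.remainder_isSuperderivation c (h'.trans hV) (h'.trans h)
  have hg' := c.isGrassmann (h'.trans h)
  have hr : ∀ r : ℝ, Y.remainder c (h'.trans hV) (h'.trans h)
      (c.pull _ (h'.trans h) (algebraMap ℝ _ r)) = 0 := fun r => by
    rw [AlgHom.commutes, Algebra.algebraMap_eq_smul_one, map_smul,
      hD.map_one (X.isSupercommutative _), smul_zero]
  rw [map_add, map_add, hr, zero_add, map_sum, map_sum, map_sum, Finset.sum_apply,
    AddSubmonoidClass.coe_finsetSum, Finset.sum_apply]
  refine Finset.sum_eq_zero fun i _ => ?_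
  have hc := Y.remainder_coord c (h'.trans hV) (h'.trans h) (Sum.inl i)
  rw [c.res_coord_inl] at hc
  rw [map_mul, hD.leibniz_even (hg'.map_mem _), map_sub, map_sub, hc, hr, sub_zero, zero_mul,
    zero_add, ← map_sub, hg'.coeff_map_mul]
  change (y.1 i - y.1 i) * _ = 0
  rw [sub_self, zero_mul]

/-- A vector field is determined by its components: `Y = ∑ Y(x^a) ∂/∂x^a`. -/
theorem apply_eq_sum (Y : SuperVectorField X V ε) (c : X.Chart p q)
    {W : Opens X.carrier} (hV : W ≤ V) (h : W ≤ c.dom) (f : X.sec W) :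
    Y.toFun W hV f = ∑ a, Y.toFun W hV (X.res h (c.coord a)) * c.pderivₗ a h f := by
  rw [← sub_eq_zero, ← remainder_apply]
  exact (c.isGrassmann h).superderivation_eq_zero (Y.remainder_isSuperderivation c hV h)
    (Y.remainder_pull c hV h) (fun j => Y.remainder_coord c hV h (Sum.inr j)) f

end SuperVectorField

namespace smoothFunctions

/-- Restriction as a homomorphism of algebras. -/
def restrictₐ {p : ℕ} {Ω Ω' : Opens (Fin p → ℝ)} (h : Ω' ≤ Ω) :
    smoothFunctions Ω →ₐ[ℝ] smoothFunctions Ω' where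
  toFun := restrict h
  map_one' := rfl
  map_mul' _ _ := rfl
  map_zero' := rfl
  map_add' _ _ := rfl
  commutes' _ := rfl

end smoothFunctions

theorem openImage_restrOpen {M : Type u} [TopologicalSpace M] {p : ℕ}
    (φ : OpenPartialHomeomorph M (Fin p → ℝ)) {U W : Opens M} (h : W ≤ U) :
    openImage (φ.restrOpen U U.isOpen) W = openImage φ W := by
  ext x
  constructor
  · rintro ⟨h1, h2⟩
    rw [φ.restrOpen_toPartialEquiv] at h1
    exact ⟨h1.1, h2⟩
  · rintro ⟨h1, h2⟩
    refine ⟨?_, h2⟩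
    rw [φ.restrOpen_toPartialEquiv]
    exact ⟨h1, h h2⟩

/-! ### Restriction of charts and the chain rule -/

namespace SuperSpace

variable {X : SuperSpace.{u}} {p q : ℕ}

namespace Chart

/-- The restriction of a chart to an open part of its domain. -/
noncomputable def restrict (c : X.Chart p q) (U : Opens X.carrier) (hU : U ≤ c.dom) :
    X.Chart p q where
  φ := c.φ.restrOpen U U.isOpen
  dom := U
  dom_eq := by
    rw [c.φ.restrOpen_source, ← c.dom_eq, Set.inter_eq_right.2 hU]
  -- The images of W under φ and under its restriction are equal only propositionally, so the
  -- restriction map between the two equal open sets is inserted.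
  pull W h := (c.pull W (h.trans hU)).comp
    (smoothFunctions.restrictₐ (openImage_restrOpen c.φ h).ge)
  pull_even W h f := c.pull_even _ _ _
  res_pull W W' h h' f := c.res_pull _ _ _ _ _
  θ j := X.res hU (c.θ j)
  θ_odd j := X.res_mem_gr _ _ hU _ _ (c.θ_odd j)
  expansion_bijective W h := by
    have hb := c.expansion_bijective W (h.trans hU)
    have hr : Function.Bijective
        (smoothFunctions.restrictₐ (openImage_restrOpen c.φ h).ge) :=
      ⟨fun f g hfg => smoothFunctions.ext_apply fun x =>
        congrFun (congrArg Subtype.val hfg) ⟨x.1, (openImage_restrOpen c.φ h).le x.2⟩,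
        fun f => ⟨smoothFunctions.restrict (openImage_restrOpen c.φ h).le f, rfl⟩⟩
    have := hb.comp (hr.comp_left (α := Finset (Fin q)))
    convert this using 1
    funext f
    simp only [res_res]
    rfl

/-- The field `∂/∂x^a` on the domain of a chart. -/
noncomputable def coordField (c : X.Chart p q) (a : Fin p ⊕ Fin q) :
    SuperVectorField X c.dom (coordParity a) where
  toFun _ h := c.pderivₗ a h
  res_apply _ _ h h' f := c.res_pderivₗ h h' a f
  mem_gr _ h _ _ hf := ((c.isCoordinateFrame h).superderivation a).mem hf
  leibniz _ h _ _ hf g := ((c.isCoordinateFrame h).superderivation a).leibniz hf g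

/-- The chain rule, obtained by expanding the vector field ∂/∂x^a of one chart in the other; no
composition of smooth functions is differentiated. -/
theorem pderivₗ_eq_sum (c c' : X.Chart p q) {W : Opens X.carrier} (h : W ≤ c.dom)
    (h' : W ≤ c'.dom) (a : Fin p ⊕ Fin q) (f : X.sec W) :
    c.pderivₗ a h f = ∑ b, c.pderivₗ a h (X.res h' (c'.coord b)) * c'.pderivₗ b h' f :=
  (c.coordField a).apply_eq_sum c' h h' f

theorem sum_pderivₗ_mul_pderivₗ (c c' : X.Chart p q) {W : Opens X.carrier} (h : W ≤ c.dom)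
    (h' : W ≤ c'.dom) (a e : Fin p ⊕ Fin q) :
    ∑ b, c.pderivₗ a h (X.res h' (c'.coord b)) * c'.pderivₗ b h' (X.res h (c.coord e)) =
      if a = e then 1 else 0 := by
  rw [← pderivₗ_eq_sum, pderivₗ_coord]

end Chart

end SuperSpace

/-! ### Gluing functions from charts -/

namespace Supermanifold

variable {p q : ℕ} (M : Supermanifold.{u} p q)

theorem exists_chart_le (V : Opens M.carrier) (x : M.carrier) (hx : x ∈ V) :
    ∃ c : M.Atlas, c.dom ≤ V ∧ x ∈ c.dom := by
  obtain ⟨c, hc⟩ := M.exists_chart x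
  exact ⟨c.restrict (c.dom ⊓ V) inf_le_left, inf_le_right, hc, hx⟩

theorem le_iSup_chart (V : Opens M.carrier) :
    V ≤ ⨆ c : {c : M.Atlas // c.dom ≤ V}, c.1.dom := fun x hx => by
  obtain ⟨c, hc, hxc⟩ := M.exists_chart_le V x hx
  exact Opens.mem_iSup.2 ⟨⟨c, hc⟩, hxc⟩

theorem eq_of_res_eq {V : Opens M.carrier} {s t : M.sec V}
    (h : ∀ (c : M.Atlas) (hc : c.dom ≤ V), M.res hc s = M.res hc t) : s = t :=
  TopCat.Sheaf.eq_of_locally_eq' M.sheaf (fun c : {c : M.Atlas // c.dom ≤ V} => c.1.dom) V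
    (fun c => homOfLE c.2) (M.le_iSup_chart V) s t (fun c => h c.1 c.2)

theorem exists_section {V : Opens M.carrier} (σ : ∀ c : M.Atlas, c.dom ≤ V → M.sec c.dom)
    (hσ : ∀ (c c' : M.Atlas) (hc : c.dom ≤ V) (hc' : c'.dom ≤ V),
      M.res (inf_le_left : c.dom ⊓ c'.dom ≤ c.dom) (σ c hc) =
        M.res (inf_le_right : c.dom ⊓ c'.dom ≤ c'.dom) (σ c' hc')) :
    ∃ s : M.sec V, ∀ (c : M.Atlas) (hc : c.dom ≤ V), M.res hc s = σ c hc := by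
  obtain ⟨s, hs, -⟩ := TopCat.Sheaf.existsUnique_gluing' M.sheaf
    (fun c : {c : M.Atlas // c.dom ≤ V} => c.1.dom) V
    (fun c => homOfLE c.2) (M.le_iSup_chart V) (fun c => σ c.1 c.2)
    (fun c c' => hσ c.1 c'.1 c.2 c'.2)
  exact ⟨s, fun c hc => hs ⟨c, hc⟩⟩

/-- The component of the wrong parity restricts to zero in every chart, because even and odd
functions meet only in zero; hence it vanishes. -/
theorem mem_gr_of_res {V : Opens M.carrier} {s : M.sec V} {i : ZMod 2}
    (h : ∀ (c : M.Atlas) (hc : c.dom ≤ V), M.res hc s ∈ M.gr c.dom i) : s ∈ M.gr V i := by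
  obtain ⟨a, ha, b, hb, rfl⟩ := (M.isSupercommutative V).exists_add s
  have h2 : ∀ k : ZMod 2, k = 0 ∨ k = 1 := by decide
  rcases h2 i with rfl | rfl
  · have : b = 0 := M.eq_of_res_eq fun c hc => by
      have h1 := h c hc
      rw [map_add] at h1
      have h3 := (Submodule.add_mem_iff_right _ (M.res_mem_gr _ _ hc _ _ ha)).1 h1
      rw [map_zero]
      exact Submodule.disjoint_def.1 (M.gr_isCompl _).disjoint _ h3 (M.res_mem_gr _ _ hc _ _ hb)
    rwa [this, add_zero]
  · have : a = 0 := M.eq_of_res_eq fun c hc => by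
      have h1 := h c hc
      rw [map_add] at h1
      have h3 := (Submodule.add_mem_iff_left _ (M.res_mem_gr _ _ hc _ _ hb)).1 h1
      rw [map_zero]
      exact Submodule.disjoint_def.1 (M.gr_isCompl _).disjoint _ (M.res_mem_gr _ _ hc _ _ ha) h3
    rwa [this, zero_add]

end Supermanifold

/-! ### Divergence with respect to a volume form -/

namespace VolumeForm

variable {p q : ℕ} {M : Supermanifold.{u} p q} (ρ : VolumeForm M)

theorem lieDerivative_eq {V : Opens M.carrier} {ε : ZMod 2}
    (Y : SuperVectorField M.toSuperSpace V ε) (c : M.Atlas) (hc : c.dom ≤ V) :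
    ρ.lieDerivative Y c hc = superDiv SuperSpace.coordParity (fun a => c.pderivₗ a le_rfl)
      (ρ.coeff c) ε (fun a => Y.toFun c.dom hc (M.res le_rfl (c.coord a))) := by
  simp only [lieDerivative, superDiv, SuperSpace.Chart.pderivₗ_apply, SuperSpace.res_self]

theorem res_lieDerivative {V W : Opens M.carrier} {ε : ZMod 2}
    (Y : SuperVectorField M.toSuperSpace V ε) (c : M.Atlas) (hc : c.dom ≤ V) (h : W ≤ c.dom) :
    M.res h (ρ.lieDerivative Y c hc) = superDiv SuperSpace.coordParity (fun a => c.pderivₗ a h)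
      (M.res h (ρ.coeff c)) ε (fun a => Y.toFun W (h.trans hc) (M.res h (c.coord a))) := by
  rw [lieDerivative_eq]
  simp only [superDiv]
  rw [map_sum (M.res h)]
  refine Finset.sum_congr rfl fun a _ => ?_
  rw [map_smul, c.res_pderivₗ, map_mul, Y.res_apply, SuperSpace.res_res]

/-- The Lie derivative of a volume form transforms as a volume form. -/
theorem lieDerivative_compatible (hρ : ρ.Nondegenerate) {V : Opens M.carrier} {ε : ZMod 2}
    (Y : SuperVectorField M.toSuperSpace V ε) (c c' : M.Atlas) (hc : c.dom ≤ V)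
    (hc' : c'.dom ≤ V) :
    M.res (inf_le_left : c.dom ⊓ c'.dom ≤ c.dom) (ρ.lieDerivative Y c hc) =
      M.berezinian (c.dom ⊓ c'.dom) (c.jacobian c') *
        M.res (inf_le_right : c.dom ⊓ c'.dom ≤ c'.dom) (ρ.lieDerivative Y c' hc') := by
  have h : c.dom ⊓ c'.dom ≤ c.dom := inf_le_left
  have h' : c.dom ⊓ c'.dom ≤ c'.dom := inf_le_right
  have F := c.isCoordinateFrame h
  have F' := c'.isCoordinateFrame h'
  have hG := M.isSupercommutative (c.dom ⊓ c'.dom)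
  -- The Berezinian is the quotient of the two invertible coefficients of ρ, so its invertibility
  -- comes from nondegeneracy.
  have hu : IsUnit (M.berezinian (c.dom ⊓ c'.dom) (c.jacobian c') : M.sec (c.dom ⊓ c'.dom)) := by
    have h1 := (hρ c).map (M.res h)
    rw [ρ.compatible c c'] at h1
    obtain ⟨v, hv⟩ := (hρ c').map (M.res h')
    rw [← hv] at h1
    exact (Units.isUnit_units_mul v _).1 h1
  have hJ : ∀ a b, c.jacobian c' a b = c.pderivₗ a h (M.res h' (c'.coord b)) := fun a b =>
    (c.pderivₗ_apply a h _).symm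
  have hKJ : (Matrix.of fun b a => c'.pderivₗ b h' (M.res h (c.coord a))) * c.jacobian c' = 1 := by
    ext b e
    rw [Matrix.mul_apply, Matrix.one_apply, ← c'.sum_pderivₗ_mul_pderivₗ c h' h b e]
    exact Finset.sum_congr rfl fun a _ => by rw [hJ]; rfl
  rw [res_lieDerivative, res_lieDerivative, ρ.compatible c c']
  refine superDiv_change hG F F' (fun b f => c'.pderivₗ_eq_sum c h' h b f)
    (fun a e => c.sum_pderivₗ_mul_pderivₗ c' h h' a e)
    (M.res_mem_gr _ _ h' _ _ (ρ.even c')) (M.berezinian _ _).2 (fun a => ?_)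
    (fun a => (Y.isSuperderivation _).mem (F.x_mem a)) (fun b => Y.apply_eq_sum c _ h _)
  rw [M.berezinian_liouville (fun a b => ?_) hKJ hu (F.superderivation a)]
  · simp only [hJ]; rfl
  · rw [hJ]; exact (F.superderivation a).mem (F'.x_mem b)

/-- The coefficients of L_Y ρ and of ρ change by the same factor, the Berezinian, so their quotients
agree on overlaps and glue. -/
theorem exists_divergence (hρ : ρ.Nondegenerate) {V : Opens M.carrier} {ε : ZMod 2}
    (Y : SuperVectorField M.toSuperSpace V ε) : ∃ d : M.sec V,
      ∀ (c : M.Atlas) (hc : c.dom ≤ V), M.res hc d * ρ.coeff c = ρ.lieDerivative Y c hc := by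
  obtain ⟨d, hd⟩ := M.exists_section
    (fun c hc => ρ.lieDerivative Y c hc * ((hρ c).unit⁻¹ : (M.sec c.dom)ˣ)) (fun c c' hc hc' => by
      set U : Opens M.carrier := c.dom ⊓ c'.dom
      have h : U ≤ c.dom := inf_le_left
      have h' : U ≤ c'.dom := inf_le_right
      apply ((hρ c).map (M.res h)).mul_right_cancel
      have e := ρ.lieDerivative_compatible hρ Y c c' hc hc'
      have e1 : ∀ c : M.Atlas, ((hρ c).unit⁻¹ : (M.sec c.dom)ˣ) * ρ.coeff c = 1 := fun c => by
        have := (hρ c).unit.inv_mul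
        exact this
      rw [← map_mul, mul_assoc, e1, mul_one, e, ρ.compatible c c', ← mul_assoc, ← map_mul,
        mul_assoc (ρ.lieDerivative Y c' hc'), e1, mul_one]
      exact (M.isSupercommutative U).commute_of_mem_zero (M.berezinian _ _).2 _)
  refine ⟨d, fun c hc => ?_⟩
  rw [hd, mul_assoc]
  have := (hρ c).unit.inv_mul
  refine (congrArg (ρ.lieDerivative Y c hc * ·) this).trans (mul_one _)

/-- The divergence `(L_Y ρ) / ρ` of a vector field. -/
noncomputable def divergence (hρ : ρ.Nondegenerate) {V : Opens M.carrier} {ε : ZMod 2}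
    (Y : SuperVectorField M.toSuperSpace V ε) : M.sec V := (ρ.exists_divergence hρ Y).choose

theorem res_divergence_mul (hρ : ρ.Nondegenerate) {V : Opens M.carrier} {ε : ZMod 2}
    (Y : SuperVectorField M.toSuperSpace V ε) (c : M.Atlas) (hc : c.dom ≤ V) :
    M.res hc (ρ.divergence hρ Y) * ρ.coeff c = ρ.lieDerivative Y c hc :=
  (ρ.exists_divergence hρ Y).choose_spec c hc

theorem eq_of_res_mul_eq (hρ : ρ.Nondegenerate) {V : Opens M.carrier} {d e : M.sec V}
    (h : ∀ (c : M.Atlas) (hc : c.dom ≤ V),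
      M.res hc d * ρ.coeff c = M.res hc e * ρ.coeff c) : d = e :=
  M.eq_of_res_eq fun c hc => (hρ c).mul_right_cancel (h c hc)

theorem lieDerivative_mem {V : Opens M.carrier} {ε : ZMod 2}
    (Y : SuperVectorField M.toSuperSpace V ε) (c : M.Atlas) (hc : c.dom ≤ V) :
    ρ.lieDerivative Y c hc ∈ M.gr c.dom ε := by
  rw [lieDerivative_eq]
  exact superDiv_mem (M.isSupercommutative _) (c.isCoordinateFrame le_rfl) (ρ.even c)
    (fun a => (Y.isSuperderivation hc).mem ((c.isCoordinateFrame le_rfl).x_mem a))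

end VolumeForm

theorem SuperSpace.res_mem (X : SuperSpace.{u}) {V W : Opens X.carrier} (h : W ≤ V) {i : ZMod 2}
    {f : X.sec V} (hf : f ∈ X.gr V i) : X.res h f ∈ X.gr W i := X.res_mem_gr V W h i f hf

namespace OddPoissonStructure

variable {X : SuperSpace.{u}} (B : OddPoissonStructure X)

theorem hamiltonian_toFun {V W : Opens X.carrier} {i : ZMod 2} {f : X.sec V} (hf : f ∈ X.gr V i)
    (h : W ≤ V) (g : X.sec W) :
    (B.hamiltonian f hf).toFun W h g = koszulSign (i + 1) • B.bracket W (X.res h f) g := rfl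

/-- Antisymmetry carries the Leibniz rule to the first argument. It applies only to homogeneous
functions, hence the reduction to homogeneous k. -/
theorem bracket_mul_left {V : Opens X.carrier} {i j : ZMod 2} {f g : X.sec V}
    (hf : f ∈ X.gr V i) (hg : g ∈ X.gr V j) (k : X.sec V) :
    B.bracket V (f * g) k = f * B.bracket V g k + koszulSign (i * j) • (g * B.bracket V f k) := by
  have hG := X.isSupercommutative V
  refine hG.induction (P := fun k => B.bracket V (f * g) k =
    f * B.bracket V g k + koszulSign (i * j) • (g * B.bracket V f k)) (fun a b ha hb => ?_)
    (fun l k hk => ?_) k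
  · simp only [map_add, ha, hb, mul_add, smul_add]; abel
  · rw [B.antisymm V _ _ _ (hG.mul_mem hf hg) _ hk, B.leibniz V _ _ _ hk _ hf,
      B.antisymm V _ _ _ hk _ hf, B.antisymm V _ _ _ hk _ hg, neg_mul, smul_mul_assoc,
      hG.mul_comm (B.mem_gr V _ _ _ hf _ hk) hg]
    simp only [mul_neg, mul_smul_comm, smul_neg, smul_add, neg_add_rev, neg_neg,
      koszulSign_smul_smul]
    rw [show (i + j + 1) * (l + 1) + ((l + 1) * i + (l + 1) * (j + 1)) = 0 by
        clear * -; decide +revert,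
      show (i + j + 1) * (l + 1) + ((l + 1) * (i + 1) + (i + l + 1) * j) = i * j by
        clear * -; decide +revert, koszulSign_zero, one_smul]

end OddPoissonStructure

/-! ### The odd Laplace operator and its square -/

namespace VolumeForm

variable {p q : ℕ} {M : Supermanifold.{u} p q} (ρ : VolumeForm M)

theorem divergence_mem (hρ : ρ.Nondegenerate) {V : Opens M.carrier} {ε : ZMod 2}
    (Y : SuperVectorField M.toSuperSpace V ε) : ρ.divergence hρ Y ∈ M.gr V ε := by
  refine M.mem_gr_of_res fun c hc => ?_
  obtain ⟨b, hb⟩ := (M.isUnit_evenPart c.dom (a := ⟨ρ.coeff c, ρ.even c⟩)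
    (hρ c)).exists_right_inv
  have hb' : ρ.coeff c * (b : M.sec c.dom) = 1 := congrArg Subtype.val hb
  have := (M.isSupercommutative c.dom).mul_mem (ρ.lieDerivative_mem Y c hc) b.2
  rwa [← ρ.res_divergence_mul hρ, mul_assoc, hb', mul_one, add_zero] at this

variable (B : OddPoissonStructure M.toSuperSpace)

theorem lieDerivative_hamiltonian {V : Opens M.carrier} {i : ZMod 2} {f : M.sec V}
    (hf : f ∈ M.gr V i) (c : M.Atlas) (hc : c.dom ≤ V) :
    ρ.lieDerivative (B.hamiltonian f hf) c hc =
      ∑ a, koszulSign (SuperSpace.coordParity a * (i + 1 + 1)) • c.pderivₗ a le_rfl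
        (ρ.coeff c * koszulSign (i + 1) • B.bracket c.dom (M.res hc f)
          (M.res le_rfl (c.coord a))) := by
  rw [lieDerivative_eq]
  rfl

/-- The Laplacian on functions of parity `i`. -/
noncomputable def laplacianAux (hρ : ρ.Nondegenerate) (V : Opens M.carrier) (i : ZMod 2) :
    M.gr V i →ₗ[ℝ] M.sec V where
  toFun f := ρ.divergence hρ (B.hamiltonian f.1 f.2)
  map_add' f g := ρ.eq_of_res_mul_eq hρ fun c hc => by
    rw [map_add, add_mul, res_divergence_mul, res_divergence_mul, res_divergence_mul]
    simp only [lieDerivative_hamiltonian, Submodule.coe_add, map_add, LinearMap.add_apply,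
      smul_add, mul_add, Finset.sum_add_distrib]
  map_smul' r f := ρ.eq_of_res_mul_eq hρ fun c hc => by
    rw [RingHom.id_apply, map_smul, smul_mul_assoc, res_divergence_mul, res_divergence_mul]
    simp only [lieDerivative_hamiltonian, Submodule.coe_smul, map_smul, LinearMap.smul_apply,
      Finset.smul_sum, mul_smul_comm]
    exact Finset.sum_congr rfl fun a _ => by
      rw [smul_comm r, smul_comm r]

/-- The odd Laplace operator `Δ f = (L_{X_f} ρ) / ρ`. -/
noncomputable def laplacian (hρ : ρ.Nondegenerate) (V : Opens M.carrier) :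
    M.sec V →ₗ[ℝ] M.sec V :=
  ρ.laplacianAux B hρ V 0 ∘ₗ (M.gr V 0).projectionOnto (M.gr V 1) (M.gr_isCompl V) +
    ρ.laplacianAux B hρ V 1 ∘ₗ (M.gr V 1).projectionOnto (M.gr V 0) (M.gr_isCompl V).symm

theorem laplacian_of_mem (hρ : ρ.Nondegenerate) {V : Opens M.carrier} {i : ZMod 2} {f : M.sec V}
    (hf : f ∈ M.gr V i) : ρ.laplacian B hρ V f = ρ.divergence hρ (B.hamiltonian f hf) := by
  have h2 : ∀ k : ZMod 2, k = 0 ∨ k = 1 := by decide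
  simp only [laplacian, LinearMap.add_apply, LinearMap.comp_apply]
  rcases h2 i with rfl | rfl
  · rw [(Submodule.projectionOnto_apply_eq_zero_iff (M.gr_isCompl V).symm).2 hf, map_zero,
      add_zero]
    rw [Submodule.projectionOnto_apply_left (M.gr_isCompl V) ⟨f, hf⟩]
    rfl
  · rw [(Submodule.projectionOnto_apply_eq_zero_iff (M.gr_isCompl V)).2 hf, map_zero,
      zero_add]
    rw [Submodule.projectionOnto_apply_left (M.gr_isCompl V).symm ⟨f, hf⟩]
    rfl

theorem laplacian_mem (hρ : ρ.Nondegenerate) {V : Opens M.carrier} {i : ZMod 2} {f : M.sec V}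
    (hf : f ∈ M.gr V i) : ρ.laplacian B hρ V f ∈ M.gr V (i + 1) := by
  rw [laplacian_of_mem _ _ _ hf]
  exact ρ.divergence_mem hρ _

theorem res_laplacian_mul (hρ : ρ.Nondegenerate) {V : Opens M.carrier} {i : ZMod 2} {f : M.sec V}
    (hf : f ∈ M.gr V i) (c : M.Atlas) (hc : c.dom ≤ V) :
    M.res hc (ρ.laplacian B hρ V f) * ρ.coeff c = superDiv SuperSpace.coordParity
      (fun a => c.pderivₗ a le_rfl) (ρ.coeff c) (i + 1)
      (fun a => (B.hamiltonian f hf).toFun c.dom hc (M.res le_rfl (c.coord a))) := by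
  rw [laplacian_of_mem _ _ _ hf, res_divergence_mul, lieDerivative_eq]

theorem isLaplaceOperator_laplacian (hρ : ρ.Nondegenerate) :
    ρ.IsLaplaceOperator B (ρ.laplacian B hρ) := fun V i f hf c hc => by
  rw [laplacian_of_mem _ _ _ hf, res_divergence_mul]

theorem IsLaplaceOperator.unique (hρ : ρ.Nondegenerate)
    {Δ Δ' : ∀ V : Opens M.carrier, M.sec V →ₗ[ℝ] M.sec V} (h : ρ.IsLaplaceOperator B Δ)
    (h' : ρ.IsLaplaceOperator B Δ') : Δ' = Δ := by
  funext V
  refine LinearMap.ext fun f => ?_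
  refine (M.isSupercommutative V).induction (P := fun f => Δ' V f = Δ V f)
    (fun a b ha hb => ?_) (fun i f hf => ?_) f
  · rw [map_add, map_add, ha, hb]
  · exact ρ.eq_of_res_mul_eq hρ fun c hc => by rw [h V i f hf c hc, h' V i f hf c hc]

theorem res_laplacian (hρ : ρ.Nondegenerate) {V W : Opens M.carrier} (h : W ≤ V) (f : M.sec V) :
    M.res h (ρ.laplacian B hρ V f) = ρ.laplacian B hρ W (M.res h f) := by
  refine (M.isSupercommutative V).induction
    (P := fun f => M.res h (ρ.laplacian B hρ V f) = ρ.laplacian B hρ W (M.res h f))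
    (fun a b ha hb => by simp only [map_add, ha, hb]) (fun i f hf => ?_) f
  refine ρ.eq_of_res_mul_eq hρ fun c hc => ?_
  rw [SuperSpace.res_res, ρ.res_laplacian_mul B hρ hf,
    ρ.res_laplacian_mul B hρ (M.res_mem h hf)]
  simp only [B.hamiltonian_toFun, SuperSpace.res_res]

/-- The Laplacian is a second order operator whose symbol is the bracket. -/
theorem laplacian_mul (hρ : ρ.Nondegenerate) {V : Opens M.carrier} {i j : ZMod 2} {f g : M.sec V}
    (hf : f ∈ M.gr V i) (hg : g ∈ M.gr V j) : ρ.laplacian B hρ V (f * g) =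
      ρ.laplacian B hρ V f * g + koszulSign i • (f * ρ.laplacian B hρ V g) +
        (2 : ℝ) • koszulSign (i + 1) • B.bracket V f g := by
  refine ρ.eq_of_res_mul_eq hρ fun c hc => ?_
  have hG := M.isSupercommutative V
  have hGc := M.isSupercommutative c.dom
  have F := c.isCoordinateFrame le_rfl
  have hf' := M.res_mem hc hf
  have hg' := M.res_mem hc hg
  -- X_{fg} is a signed combination of f X_g and g X_f, so the Leibniz rule for divergences can be
  -- applied to each of the two.
  have hv : ∀ a, (B.hamiltonian (f * g) (hG.mul_mem hf hg)).toFun c.dom hc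
      (M.res le_rfl (c.coord a)) =
      koszulSign i • (M.res hc f * (B.hamiltonian g hg).toFun c.dom hc
        (M.res le_rfl (c.coord a))) +
      koszulSign (i * j + j) • (M.res hc g * (B.hamiltonian f hf).toFun c.dom hc
        (M.res le_rfl (c.coord a))) := fun a => by
    simp only [B.hamiltonian_toFun]
    rw [map_mul (M.res hc), B.bracket_mul_left hf' hg']
    simp only [mul_smul_comm, koszulSign_smul_smul, smul_add]
    rw [show i + j + 1 = i + (j + 1) by ring,
      show i + (j + 1) + i * j = i * j + j + (i + 1) by ring]
  have hXg := (B.hamiltonian g hg).isSuperderivation hc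
  have hXf := (B.hamiltonian f hf).isSuperderivation hc
  have e1 := superDiv_mul_left hGc F (ρ.even c) hf' (fun a => hXg.mem (F.x_mem a))
  have e2 := superDiv_mul_left hGc F (ρ.even c) hg' (fun a => hXf.mem (F.x_mem a))
  rw [← (B.hamiltonian g hg).apply_eq_sum c hc le_rfl, ← ρ.res_laplacian_mul B hρ hg] at e1
  rw [← (B.hamiltonian f hf).apply_eq_sum c hc le_rfl, ← ρ.res_laplacian_mul B hρ hf] at e2
  have e3 : superDiv SuperSpace.coordParity (fun a => c.pderivₗ a le_rfl) (ρ.coeff c) (i + j + 1)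
      (fun a => (B.hamiltonian (f * g) (hG.mul_mem hf hg)).toFun c.dom hc
        (M.res le_rfl (c.coord a))) =
      koszulSign i • superDiv SuperSpace.coordParity (fun a => c.pderivₗ a le_rfl) (ρ.coeff c)
        (i + (j + 1)) (fun a => M.res hc f * (B.hamiltonian g hg).toFun c.dom hc
          (M.res le_rfl (c.coord a))) +
      koszulSign (i * j + j) • superDiv SuperSpace.coordParity (fun a => c.pderivₗ a le_rfl)
        (ρ.coeff c) (j + (i + 1)) (fun a => M.res hc g * (B.hamiltonian f hf).toFun c.dom hc
          (M.res le_rfl (c.coord a))) := by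
    simp only [superDiv, hv, mul_add, map_add, smul_add, Finset.sum_add_distrib, mul_smul_comm,
      map_smul, Finset.smul_sum, koszulSign_smul_smul]
    congr 1 <;> refine Finset.sum_congr rfl fun a _ => ?_ <;> congr 2 <;> ring
  rw [ρ.res_laplacian_mul B hρ (hG.mul_mem hf hg), e3, e1, e2]
  simp only [B.hamiltonian_toFun]
  have hΔf := M.res_mem hc (ρ.laplacian_mem B hρ hf)
  -- The two non-derivation terms come from X_g(f) and X_f(g). By antisymmetry they are equal with
  -- their signs, which explains the factor 2.
  rw [B.antisymm _ _ _ _ hg' _ hf']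
  rw [← mul_assoc (M.res hc g), hGc.mul_comm hg' hΔf]
  simp only [map_add, map_mul, map_smul, B.res_bracket, add_mul, smul_mul_assoc, smul_add,
    koszulSign_smul_smul, smul_neg, neg_mul, mul_assoc, two_smul,
    hGc.commute_of_mem_zero (ρ.even c)]
  rw [show i * j + j + j * (i + 1) = 0 by clear * -; decide +revert,
    show i + (i * (j + 1) + (j + 1 + (j * (i + 1) + 1 * (i + 1)))) = i by clear * -; decide +revert,
    show i * j + j + (j * (i + 1) + (i + 1)) = i + 1 by clear * -; decide +revert,
    koszulSign_zero, one_smul, koszulSign_add_one, neg_smul]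
  abel

/-- The Laplacian is a derivation of the bracket. -/
theorem laplacian_bracket (hρ : ρ.Nondegenerate) {V : Opens M.carrier} {i j : ZMod 2}
    {f g : M.sec V} (hf : f ∈ M.gr V i) (hg : g ∈ M.gr V j) :
    ρ.laplacian B hρ V (B.bracket V f g) =
      B.bracket V (ρ.laplacian B hρ V f) g +
        koszulSign (i + 1) • B.bracket V f (ρ.laplacian B hρ V g) := by
  refine ρ.eq_of_res_mul_eq hρ fun c hc => ?_
  have hGc := M.isSupercommutative c.dom
  have F := c.isCoordinateFrame le_rfl
  have hf' := M.res_mem hc hf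
  have hg' := M.res_mem hc hg
  have hb := B.mem_gr V _ _ _ hf _ hg
  -- By the Jacobi identity the Hamiltonian field of {f,g} is the supercommutator of X_f and X_g,
  -- whose divergence is known.
  have hZ : (B.hamiltonian _ hb).toFun c.dom hc =
      (B.hamiltonian f hf).toFun c.dom hc ∘ₗ (B.hamiltonian g hg).toFun c.dom hc -
      koszulSign ((i + 1) * (j + 1)) •
        (B.hamiltonian g hg).toFun c.dom hc ∘ₗ (B.hamiltonian f hf).toFun c.dom hc := by
    refine LinearMap.ext fun k => ?_
    simp only [LinearMap.sub_apply, LinearMap.smul_apply, LinearMap.comp_apply,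
      B.hamiltonian_toFun, map_smul, B.res_bracket]
    rw [B.jacobi _ _ _ _ hf' _ hg']
    simp only [smul_add, koszulSign_smul_smul]
    rw [show i + 1 + (j + 1) = i + j + 1 + 1 by ring,
      show (i + 1) * (j + 1) + (j + 1 + (i + 1)) = i + j + 1 + 1 + (i + 1) * (j + 1) by ring,
      show i + 1 + (j + 1 + (i + 1) * (j + 1)) = i + j + 1 + 1 + (i + 1) * (j + 1) by ring,
      add_sub_cancel_right]
  have key := superDiv_bracket hGc F (ρ.even c) (hρ c)
    ((B.hamiltonian f hf).isSuperderivation hc) ((B.hamiltonian g hg).isSuperderivation hc)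
    ((B.hamiltonian f hf).apply_eq_sum c hc le_rfl) ((B.hamiltonian g hg).apply_eq_sum c hc le_rfl)
    hZ ((B.hamiltonian _ hb).apply_eq_sum c hc le_rfl)
    (ρ.res_laplacian_mul B hρ hf c hc) (ρ.res_laplacian_mul B hρ hg c hc)
  rw [show i + 1 + (j + 1) = i + j + 1 + 1 by ring] at key
  rw [ρ.res_laplacian_mul B hρ hb, key]
  congr 1
  have hΔf := M.res_mem hc (ρ.laplacian_mem B hρ hf)
  simp only [B.hamiltonian_toFun, map_add, map_smul, B.res_bracket]
  rw [B.antisymm _ _ _ _ hg' _ hΔf, smul_neg, smul_neg, sub_neg_eq_add, koszulSign_smul_smul,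
    koszulSign_smul_smul, add_comm]
  rw [show (i + 1) * (j + 1) + (j + 1) + (j + 1) * (i + 1 + 1) = 0 by clear * -; decide +revert,
    koszulSign_zero, one_smul]

/-- Expand by `laplacian_mul` twice. The terms Δf·Δg cancel because Δ is odd, and the brackets
{Δf,g} and {f,Δg} cancel against those in Δ{f,g} from `laplacian_bracket`. -/
theorem laplacian_laplacian_mul (hρ : ρ.Nondegenerate) {V : Opens M.carrier} {i : ZMod 2}
    {f : M.sec V} (hf : f ∈ M.gr V i) (g : M.sec V) :
    ρ.laplacian B hρ V (ρ.laplacian B hρ V (f * g)) =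
      ρ.laplacian B hρ V (ρ.laplacian B hρ V f) * g +
        f * ρ.laplacian B hρ V (ρ.laplacian B hρ V g) := by
  refine (M.isSupercommutative V).induction (P := fun g =>
    ρ.laplacian B hρ V (ρ.laplacian B hρ V (f * g)) =
      ρ.laplacian B hρ V (ρ.laplacian B hρ V f) * g +
        f * ρ.laplacian B hρ V (ρ.laplacian B hρ V g))
    (fun a b ha hb => by simp only [mul_add, map_add, ha, hb]; abel) (fun j g hg => ?_) g
  rw [ρ.laplacian_mul B hρ hf hg]
  simp only [map_add, map_smul]
  rw [ρ.laplacian_mul B hρ (ρ.laplacian_mem B hρ hf) hg,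
    ρ.laplacian_mul B hρ hf (ρ.laplacian_mem B hρ hg), ρ.laplacian_bracket B hρ hf hg]
  simp only [smul_add, koszulSign_smul_smul, koszulSign_add_one,
    neg_smul, smul_neg, CharTwo.add_self_eq_zero, koszulSign_zero, one_smul, neg_neg, two_smul]
  abel

/-- The modular vector field `Δ²`. -/
noncomputable def modularField (hρ : ρ.Nondegenerate) : SuperVectorField M.toSuperSpace ⊤ 0 where
  toFun W _ := ρ.laplacian B hρ W ∘ₗ ρ.laplacian B hρ W
  res_apply W W' _ h' f := by
    rw [LinearMap.comp_apply, LinearMap.comp_apply, res_laplacian, res_laplacian]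
  mem_gr W _ i f hf := by
    have := ρ.laplacian_mem B hρ (ρ.laplacian_mem B hρ hf)
    rwa [add_assoc, CharTwo.add_self_eq_zero, add_comm] at this
  leibniz W _ i f hf g := by
    rw [zero_mul, koszulSign_zero, one_smul]
    exact ρ.laplacian_laplacian_mul B hρ hf g

end VolumeForm

/-! ### Berezin integration -/

namespace IsGrassmann

variable {q : ℕ} {R A : Type*} [CommRing R] [Algebra ℝ R] [Ring A] [Algebra ℝ A]
  {G : ZMod 2 → Submodule ℝ A} {P : R →ₐ[ℝ] A} {τ : Fin q → A}

theorem coeff_odd_mul (h : IsGrassmann G P τ) {k : Fin q} {K : Finset (Fin q)} (hk : k ∈ K)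
    (a : A) : h.coeff (τ k * a) K =
      (-1 : ℝ) ^ ((K.erase k).filter (· < k)).card • h.coeff a (K.erase k) := by
  induction a using h.induction with
  | h0 => simp
  | hadd a b ha hb => simp only [mul_add, map_add, Pi.add_apply, ha, hb, smul_add]
  | hm f I =>
    rw [← mul_assoc, ← h.central, mul_assoc, mul_oddMonomial h.anticomm, h.coeff_monomial]
    by_cases hI : I = K.erase k
    · subst hI
      rw [if_neg (Finset.notMem_erase k K), mul_smul_comm, map_smul, h.coeff_monomial,
        Finset.insert_erase hk]
      simp
    · rw [Pi.single_eq_of_ne (Ne.symm hI), smul_zero]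
      split_ifs with hkI
      · simp
      · rw [mul_smul_comm, map_smul, h.coeff_monomial, Pi.smul_apply, Pi.single_eq_of_ne,
          smul_zero]
        rintro rfl
        exact hI (Finset.erase_insert hkI).symm

/-- Multiplication by τ^J moves the coefficient at K ∖ J to K up to a nonzero scalar. With K the
full set and J the complement of I, it makes any coefficient visible to the Berezin integral, which
reads only the top one. -/
theorem exists_coeff_oddMonomial_mul (h : IsGrassmann G P τ) (J : Finset (Fin q)) :
    ∀ K, J ⊆ K → ∃ r : ℝ, r ≠ 0 ∧ ∀ a, h.coeff (oddMonomial τ J * a) K = r • h.coeff a (K \ J) := by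
  induction J using Finset.induction_on_min with
  | empty => exact fun K _ => ⟨1, one_ne_zero, fun a => by simp [oddMonomial_empty]⟩
  | insert m J hm ih =>
    intro K hK
    have hmK : m ∈ K := hK (Finset.mem_insert_self _ _)
    have hmJ : m ∉ J := fun h => lt_irrefl _ (hm m h)
    obtain ⟨r, hr, e⟩ := ih (K.erase m)
      (Finset.subset_erase.2 ⟨(Finset.subset_insert _ _).trans hK, hmJ⟩)
    refine ⟨(-1) ^ ((K.erase m).filter (· < m)).card * r, mul_ne_zero (pow_ne_zero _ (by norm_num)) hr, fun a => ?_⟩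
    have hs : K.erase m \ J = K \ insert m J := by
      ext i
      simp only [Finset.mem_sdiff, Finset.mem_erase, Finset.mem_insert]
      tauto
    rw [oddMonomial_insert_of_lt τ hm, mul_assoc, h.coeff_odd_mul hmK, e, smul_smul, hs]

end IsGrassmann

/-! ### Compactly supported smooth functions -/

namespace smoothFunctions

variable {p : ℕ} {Ω : Opens (Fin p → ℝ)}

/-- The extension of a smooth function by zero. -/
noncomputable def ext0 (f : smoothFunctions Ω) : (Fin p → ℝ) → ℝ :=
  Function.extend Subtype.val f.1 0

theorem ext0_of_notMem (f : smoothFunctions Ω) {x : Fin p → ℝ} (hx : x ∉ Ω) : ext0 f x = 0 :=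
  Function.extend_apply' _ _ _ fun ⟨y, hy⟩ => hx (hy ▸ y.2)

theorem ext0_of_mem (f : smoothFunctions Ω) {x : Fin p → ℝ} (hx : x ∈ Ω) :
    ext0 f x = f.1 ⟨x, hx⟩ := extend_val_of_mem f.1 hx

variable {f : smoothFunctions Ω} {K : Set (Fin p → ℝ)}

theorem ext0_eq_zero (hf : ∀ x : Ω, x.1 ∉ K → f.1 x = 0) {x : Fin p → ℝ} (hx : x ∉ K) :
    ext0 f x = 0 := by
  by_cases h : x ∈ Ω
  · rw [ext0_of_mem f h, hf _ hx]
  · exact ext0_of_notMem f h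

theorem hasCompactSupport_ext0 (hK : IsCompact K) (hf : ∀ x : Ω, x.1 ∉ K → f.1 x = 0) :
    HasCompactSupport (ext0 f) := HasCompactSupport.intro hK fun _ => ext0_eq_zero hf

theorem contDiff_ext0 (hK : IsCompact K) (hKΩ : K ⊆ Ω) (hf : ∀ x : Ω, x.1 ∉ K → f.1 x = 0) :
    ContDiff ℝ ∞ (ext0 f) := by
  rw [contDiff_iff_contDiffAt]
  intro x
  by_cases hx : x ∈ Ω
  · exact contDiffAt_extend f ⟨x, hx⟩
  · refine (contDiffAt_const (c := (0 : ℝ))).congr_of_eventuallyEq ?_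
    filter_upwards [hK.isClosed.isOpen_compl.mem_nhds fun h => hx (hKΩ h)] with z hz
    exact ext0_eq_zero hf hz

theorem ext0_partialDeriv (hK : IsCompact K) (hKΩ : K ⊆ Ω)
    (hf : ∀ x : Ω, x.1 ∉ K → f.1 x = 0) (i : Fin p) :
    ext0 (partialDeriv i f) = fun x => fderiv ℝ (ext0 f) x (Pi.single i 1) := by
  funext x
  by_cases hx : x ∈ Ω
  · rw [ext0_of_mem _ hx]; rfl
  · rw [ext0_of_notMem _ hx]
    have : ext0 f =ᶠ[nhds x] fun _ => 0 := by
      filter_upwards [hK.isClosed.isOpen_compl.mem_nhds fun h => hx (hKΩ h)] with z hz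
      exact ext0_eq_zero hf hz
    rw [this.fderiv_eq]
    simp

theorem integrable_ext0_partialDeriv (hK : IsCompact K) (hKΩ : K ⊆ Ω)
    (hf : ∀ x : Ω, x.1 ∉ K → f.1 x = 0) (i : Fin p) :
    MeasureTheory.Integrable (ext0 (partialDeriv i f)) := by
  rw [ext0_partialDeriv hK hKΩ hf]
  refine Continuous.integrable_of_hasCompactSupport ?_ ?_
  · exact ((contDiff_ext0 hK hKΩ hf).continuous_fderiv (by simp)).clm_apply continuous_const
  · exact (hasCompactSupport_ext0 hK hf).fderiv_apply ℝ _

theorem integral_ext0_partialDeriv (hK : IsCompact K) (hKΩ : K ⊆ Ω)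
    (hf : ∀ x : Ω, x.1 ∉ K → f.1 x = 0) (i : Fin p) :
    ∫ x, ext0 (partialDeriv i f) x = 0 := by
  have hi := integrable_ext0_partialDeriv hK hKΩ hf i
  rw [ext0_partialDeriv hK hKΩ hf] at hi ⊢
  have hc := contDiff_ext0 hK hKΩ hf
  -- Integration by parts against the constant 1.
  have := integral_mul_fderiv_eq_neg_fderiv_mul_of_integrable (μ := MeasureTheory.volume)
    (f := fun _ => (1 : ℝ)) (g := ext0 f) (v := Pi.single i 1) (by simp) (by simpa using hi)
    (by simpa using hc.continuous.integrable_of_hasCompactSupport (hasCompactSupport_ext0 hK hf))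
    (fun x _ => differentiableAt_const _) (fun x _ => hc.differentiable (by simp) x)
  simpa using this

/-- A smooth function which is orthogonal to all compactly supported ones vanishes. -/
theorem eq_zero_of_integral_mul (f : smoothFunctions Ω)
    (h : ∀ (K : Set (Fin p → ℝ)) (g : smoothFunctions Ω), IsCompact K → K ⊆ Ω →
      (∀ x : Ω, x.1 ∉ K → g.1 x = 0) → ∫ x, ext0 (g * f) x = 0) : f = 0 := by
  refine ext_apply fun y => ?_
  by_contra hy
  obtain ⟨r, hr, hrΩ⟩ := Metric.isOpen_iff.1 Ω.isOpen y.1 y.2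
  let χ : ContDiffBump y.1 := ⟨r / 4, r / 2, by positivity, by linarith⟩
  have hs : tsupport χ ⊆ Ω := by
    rw [χ.tsupport_eq]
    exact (Metric.closedBall_subset_ball (by change r / 2 < r; linarith)).trans hrΩ
  have hg := contDiff_mul_extend f χ.contDiff hs
  have h0 : ∀ x, x ∉ tsupport χ → χ x = 0 := fun x hx => image_eq_zero_of_notMem_tsupport hx
  -- The test function is χf: if f(y) ≠ 0, the integral of χf² is strictly positive.
  have key := h (tsupport χ) (ofContDiff Ω _ hg) χ.hasCompactSupport hs
    (fun x hx => by change χ x.1 * _ = 0; rw [h0 _ hx, zero_mul])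
  have e : ext0 (ofContDiff Ω _ hg * f) =
      fun x => χ x * Function.extend Subtype.val (f * f).1 0 x := by
    funext x
    by_cases hx : x ∈ Ω
    · rw [ext0_of_mem _ hx, extend_val_of_mem _ hx]
      change χ x * Function.extend Subtype.val f.1 0 x * f.1 ⟨x, hx⟩ = χ x * (f.1 _ * f.1 _)
      rw [extend_val_of_mem _ hx, mul_assoc]
    · rw [ext0_of_notMem _ hx, h0 x fun h => hx (hs h), zero_mul]
  rw [e] at key
  have hpos := (contDiff_mul_extend (f * f) χ.contDiff hs).continuous.integral_pos_of_hasCompactSupport_nonneg_nonzero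
    (μ := MeasureTheory.volume) (χ.hasCompactSupport.mul_right) (fun x => ?_) (x := y.1) ?_
  · exact hpos.ne' key
  · refine mul_nonneg χ.nonneg ?_
    by_cases hx : x ∈ Ω
    · rw [extend_val_of_mem _ hx]; exact mul_self_nonneg _
    · exact (ext0_of_notMem (f * f) hx).ge
  · rw [extend_val_of_mem _ y.2, χ.one_of_mem_closedBall (Metric.mem_closedBall_self χ.rIn_pos.le), one_mul]
    exact mul_self_ne_zero.2 hy

end smoothFunctions

namespace SuperSpace.Chart

variable {X : SuperSpace.{u}} {p q : ℕ} (c : X.Chart p q)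

/-- The Berezin integral of a function on the domain of a chart. -/
noncomputable def berezinIntegral (s : X.sec c.dom) : ℝ :=
  ∫ x, smoothFunctions.ext0 ((c.isGrassmann le_rfl).coeff s Finset.univ) x

theorem coeff_eq_zero_of_res_eq_zero {s : X.sec c.dom} {U : Opens (Fin p → ℝ)}
    (hs : X.res (inf_le_left : c.dom ⊓ c.preimage U ≤ c.dom) s = 0) (I : Finset (Fin q))
    (x : openImage c.φ c.dom) (hx : x.1 ∈ U) : ((c.isGrassmann le_rfl).coeff s I).1 x = 0 := by
  have h := c.coeff_res le_rfl (inf_le_left : c.dom ⊓ c.preimage U ≤ c.dom) s I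
  rw [hs, map_zero] at h
  have hx' : x.1 ∈ openImage c.φ (c.dom ⊓ c.preimage U) := by
    rw [c.openImage_inf_preimage]; exact ⟨x.2, hx⟩
  exact (congrFun (congrArg Subtype.val h) ⟨x.1, hx'⟩).symm

/-- The Berezin integral of a total divergence with compact support vanishes. -/
theorem berezinIntegral_sum_pderivₗ {K : Set (Fin p → ℝ)} (hK : IsCompact K)
    (hKc : K ⊆ openImage c.φ c.dom) (s : Fin p ⊕ Fin q → X.sec c.dom)
    (hs : ∀ a, X.res (inf_le_left : c.dom ⊓ c.preimage ⟨Kᶜ, hK.isClosed.isOpen_compl⟩ ≤ c.dom)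
      (s a) = 0) : c.berezinIntegral (∑ a, c.pderivₗ a le_rfl (s a)) = 0 := by
  have hg := c.isGrassmann le_rfl
  -- A derivative with respect to θ^j contains no monomial with θ^j, so it has no top coefficient.
  have hodd : ∀ j, hg.coeff (c.pderivₗ (Sum.inr j) le_rfl (s (Sum.inr j))) Finset.univ = 0 := by
    intro j
    generalize s (Sum.inr j) = t
    change hg.coeff (hg.oddDeriv j t) Finset.univ = 0
    induction t using hg.induction with
    | h0 => simp
    | hadd a b ha hb => simp only [map_add, Pi.add_apply, ha, hb, add_zero]
    | hm f I =>
      rw [hg.oddDeriv_monomial]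
      split_ifs with hj
      · rw [map_smul, hg.coeff_monomial, Pi.smul_apply, Pi.single_eq_of_ne, smul_zero]
        exact fun h => Finset.notMem_erase j I (h ▸ Finset.mem_univ j)
      · simp
  have heven : ∀ i t, hg.coeff (c.pderivₗ (Sum.inl i) le_rfl t) Finset.univ =
      smoothFunctions.partialDeriv i (hg.coeff t Finset.univ) := by
    intro i t
    change hg.coeff (∑ I, c.pull _ _ (smoothFunctions.partialDerivₗ i (hg.coeff t I)) *
      oddMonomial _ I) Finset.univ = _
    rw [hg.coeff_sum fun I => smoothFunctions.partialDerivₗ i (hg.coeff t I)]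
    rfl
  have hv : ∀ i, ∀ x : openImage c.φ c.dom, x.1 ∉ K →
      (hg.coeff (s (Sum.inl i)) Finset.univ).1 x = 0 := fun i x hx =>
    c.coeff_eq_zero_of_res_eq_zero (hs (Sum.inl i)) _ x hx
  have e : smoothFunctions.ext0 (hg.coeff (∑ a, c.pderivₗ a le_rfl (s a)) Finset.univ) =
      fun x => ∑ i, smoothFunctions.ext0
        (smoothFunctions.partialDeriv i (hg.coeff (s (Sum.inl i)) Finset.univ)) x := by
    rw [map_sum, Finset.sum_apply, Fintype.sum_sum_type]
    simp only [hodd, heven, Finset.sum_const_zero, add_zero]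
    funext x
    by_cases hx : x ∈ openImage c.φ c.dom
    · simp only [smoothFunctions.ext0_of_mem _ hx]
      rw [AddSubmonoidClass.coe_finsetSum, Finset.sum_apply]
    · simp only [smoothFunctions.ext0_of_notMem _ hx, Finset.sum_const_zero]
  rw [berezinIntegral, e, MeasureTheory.integral_finsetSum _ fun i _ =>
    smoothFunctions.integrable_ext0_partialDeriv hK hKc (hv i) i]
  exact Finset.sum_eq_zero fun i _ => smoothFunctions.integral_ext0_partialDeriv hK hKc (hv i) i

/-- A function which is orthogonal to all compactly supported ones vanishes. -/
theorem eq_zero_of_berezinIntegral (h : X.sec c.dom)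
    (hh : ∀ (K : Set (Fin p → ℝ)) (hK : IsCompact K), K ⊆ openImage c.φ c.dom →
      ∀ (i : ZMod 2) (f : X.sec c.dom), f ∈ X.gr c.dom i →
      X.res (inf_le_left : c.dom ⊓ c.preimage ⟨Kᶜ, hK.isClosed.isOpen_compl⟩ ≤ c.dom) f = 0 →
      c.berezinIntegral (f * h) = 0) : h = 0 := by
  have hg := c.isGrassmann le_rfl
  refine hg.coeff.map_eq_zero_iff.1 (funext fun I => ?_)
  obtain ⟨r, hr, e⟩ := hg.exists_coeff_oddMonomial_mul Iᶜ Finset.univ (Finset.subset_univ _)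
  rw [← Finset.compl_eq_univ_sdiff, compl_compl] at e
  refine smoothFunctions.eq_zero_of_integral_mul _ fun K g hK hKc hgK => ?_
  have := hh K hK hKc _ _ (hg.monomial_mem (r⁻¹ • g) Iᶜ) (by
    rw [map_mul, c.res_pull]
    have : smoothFunctions.restrict (openImage_mono c.φ
        (inf_le_left : c.dom ⊓ c.preimage ⟨Kᶜ, hK.isClosed.isOpen_compl⟩ ≤ c.dom)) (r⁻¹ • g) = 0 :=
      smoothFunctions.ext_apply fun x => by
        have hx := (c.openImage_inf_preimage c.dom ⟨Kᶜ, hK.isClosed.isOpen_compl⟩).le x.2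
        change r⁻¹ * g.1 ⟨x.1, _⟩ = 0
        rw [hgK ⟨x.1, hx.1⟩ hx.2, mul_zero]
    rw [this, map_zero, zero_mul])
  rw [berezinIntegral, mul_assoc, hg.coeff_map_mul, e, smul_mul_smul_comm, inv_mul_cancel₀ hr,
    one_smul] at this
  exact this

end SuperSpace.Chart

/-! ### Invariance of the volume form under the modular field -/

namespace VolumeForm

variable {p q : ℕ} {M : Supermanifold.{u} p q} (ρ : VolumeForm M)
  (B : OddPoissonStructure M.toSuperSpace)

theorem lieDerivative_modularField (hρ : ρ.Nondegenerate) (c : M.Atlas) :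
    ρ.lieDerivative (ρ.modularField B hρ) c le_top = 0 := by
  refine c.eq_zero_of_berezinIntegral _ fun K hK hKc i f hf hfK => ?_
  set Y := ρ.modularField B hρ
  have F := c.isCoordinateFrame le_rfl
  have hG := M.isSupercommutative c.dom
  have hΔf := ρ.laplacian_mem B hρ hf
  have e1 := superDiv_mul_left hG F (ρ.even c) hf
    (fun a => (Y.isSuperderivation (le_top : c.dom ≤ ⊤)).mem (F.x_mem a))
  rw [← Y.apply_eq_sum c le_top le_rfl, mul_zero, koszulSign_zero, one_smul] at e1
  have e2 := ρ.res_laplacian_mul B hρ hΔf c le_rfl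
  rw [SuperSpace.res_self] at e2
  -- The Leibniz rule `e1` for fY, with ρ·Y(f) = Δ(Δf)·ρ replaced by the divergence of X_{Δf},
  -- writes f·L_Y ρ as a total divergence.
  have e3 : f * ρ.lieDerivative Y c le_top = ∑ a, c.pderivₗ a le_rfl
      (koszulSign (SuperSpace.coordParity a * (i + 0 + 1)) • (ρ.coeff c *
        (f * Y.toFun c.dom le_top (M.res le_rfl (c.coord a)))) -
      koszulSign (SuperSpace.coordParity a * (i + 1 + 1 + 1)) • (ρ.coeff c *
        (B.hamiltonian _ hΔf).toFun c.dom le_rfl (M.res le_rfl (c.coord a)))) := by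
    have e4 : Y.toFun c.dom le_top f = ρ.laplacian B hρ c.dom (ρ.laplacian B hρ c.dom f) := rfl
    rw [e4, hG.commute_of_mem_zero (ρ.even c), e2] at e1
    rw [lieDerivative_eq, ← sub_eq_iff_eq_add.2 e1]
    simp only [superDiv, map_sub, map_smul, Finset.sum_sub_distrib]
  rw [e3]
  -- The integrands vanish outside K because f does and because Δ and the bracket commute with
  -- restriction.
  refine c.berezinIntegral_sum_pderivₗ hK hKc _ fun a => ?_
  simp only [map_sub, map_smul, map_mul, hfK, zero_mul, mul_zero, smul_zero, B.hamiltonian_toFun,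
    B.res_bracket, ρ.res_laplacian, SuperSpace.res_self, map_zero, LinearMap.zero_apply, sub_zero]

end VolumeForm

/-- The odd Laplace operator `Δ_ρ` of a non-degenerate volume form `ρ` exists and is unique, its
square is an even vector field `Y` (the modular field), and `L_Y ρ = 0`. -/
theorem mainTheorem7 {p q : ℕ} (M : Supermanifold.{u} p q)
    (B : OddPoissonStructure M.toSuperSpace) (ρ : VolumeForm M) (hρ : ρ.Nondegenerate) :
    ∃ Δ : ∀ V : Opens M.carrier, M.sec V →ₗ[ℝ] M.sec V,
      ρ.IsLaplaceOperator B Δ ∧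
      (∀ Δ' : ∀ V : Opens M.carrier, M.sec V →ₗ[ℝ] M.sec V,
        ρ.IsLaplaceOperator B Δ' → Δ' = Δ) ∧
      ∃ Y : SuperVectorField M.toSuperSpace ⊤ 0,
        (∀ (V : Opens M.carrier) (f : M.sec V), Y.toFun V le_top f = Δ V (Δ V f)) ∧
        ∀ c : M.Atlas, ρ.lieDerivative Y c le_top = 0 :=
  ⟨ρ.laplacian B hρ, ρ.isLaplaceOperator_laplacian B hρ,
    fun _ h => VolumeForm.IsLaplaceOperator.unique ρ B hρ (ρ.isLaplaceOperator_laplacian B hρ) h,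
    ρ.modularField B hρ, fun _ _ => rfl, ρ.lieDerivative_modularField B hρ⟩
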